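/- Let $U\subset\mathbb C$ be a domain and let $\Psi:U\to[-\infty,\infty)$ be a subharmonic function ($\Psi\not\equiv-\infty$). Suppose that the distributional derivative $\partial\Psi/\partial z$ is a piecewise analytic function on $U$, i.e. there are pairwise disjoint open sets $M_1,\dots,M_r\subset U$ covering $U$ up to a set of Lebesgue measure $0$, with characteristic functions $\chi_1,\dots,\chi_r$, and pairwise distinct analytic functions $A_1,\dots,A_r$ on $U$ such that $$\frac{\partial\Psi}{\partial z}=\sum_{i=1}^r A_i\chi_i\quad\text{a.e. in }U .$$ Let $p\in U$ satisfy: (i) $p\in\overline{M_i}$ for $1\le i\le r$; (ii) $A_i(p)-A_k(p)\notin\mathbb R\,(A_j(p)-A_k(p))$ for every triple of distinct indices $i,j,k\in\{1,\dots,r\}$; (iii) $A_i(p)\ne A_k(p)$ for every pair of distinct indices $i,k\in\{1,\dots,r\}$. Then there exist an open neighborhood $\widetilde N(p)\subset U$ of $p$ and harmonic functions $H_i:\widetilde N(p)\to\mathbb R$, $1\le i\le r$, such that $\Psi(z)=\max_{1\le i\le r}H_i(z)$ for almost every $z\in\widetilde N(p)$. -/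

import Mathlib

open MeasureTheory Set
open scoped ContDiff ENNReal

noncomputable section

/-- The mean value of `u : ℂ → [-∞, ∞]` over the circle `|z - c| = R`, as an extended real number:
the mean of the positive part minus the mean of the negative part. For a function that is upper
semicontinuous and `< ∞` on the circle the first of these is finite, so the difference is the usual
integral mean with values in `[-∞, ∞)`. -/
def circleMean (u : ℂ → EReal) (c : ℂ) (R : ℝ) : EReal :=
  ((⨍⁻ θ in Ioc 0 (2 * Real.pi), (u (circleMap c R θ)).toENNReal ∂volume : ℝ≥0∞) : EReal)
    - ((⨍⁻ θ in Ioc 0 (2 * Real.pi), (-u (circleMap c R θ)).toENNReal ∂volume : ℝ≥0∞) : EReal)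

/-- `u : U → [-∞, ∞)` is subharmonic on the domain `U`: it is upper semicontinuous, not identically
`-∞`, and satisfies the sub-mean value inequality on every closed disc contained in `U`. -/
structure IsSubharmonicOn (u : ℂ → EReal) (U : Set ℂ) : Prop where
  upperSemicontinuousOn : UpperSemicontinuousOn u U
  lt_top : ∀ z ∈ U, u z < ⊤
  exists_ne_bot : ∃ z ∈ U, u z ≠ ⊥
  le_circleMean : ∀ (c : ℂ) (R : ℝ), 0 < R → Metric.closedBall c R ⊆ U → u c ≤ circleMean u c R

/-- The operator `∂/∂z = (∂/∂x - i ∂/∂y) / 2` on real-differentiable functions. -/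
def dz (φ : ℂ → ℂ) (z : ℂ) : ℂ :=
  (fderiv ℝ φ z 1 - Complex.I * fderiv ℝ φ z Complex.I) / 2

/-- `∂f/∂z = g` on the open set `U` in the sense of distributions, for `f, g ∈ L¹_loc(U)`. -/
structure HasDistribDz (f g : ℂ → ℂ) (U : Set ℂ) : Prop where
  locallyIntegrableOn_left : LocallyIntegrableOn f U
  locallyIntegrableOn_right : LocallyIntegrableOn g U
  integral_eq : ∀ φ : ℂ → ℂ, ContDiff ℝ ∞ φ → HasCompactSupport φ → tsupport φ ⊆ U →
    ∫ z, g z * φ z = -∫ z, f z * dz φ z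

/-- `Φ` is piecewise analytic on `U` with decomposition `Φ = ∑ i, A i * χ_{M i}` a.e.: the `M i` are
pairwise disjoint open subsets of `U` covering `U` up to a Lebesgue null set, the `A i` are pairwise
distinct analytic functions on `U`, and `Φ = A i` on `M i`. -/
structure IsPiecewiseAnalytic {r : ℕ} (Φ : ℂ → ℂ) (U : Set ℂ) (M : Fin r → Set ℂ)
    (A : Fin r → ℂ → ℂ) : Prop where
  isOpen : ∀ i, IsOpen (M i)
  subset : ∀ i, M i ⊆ U
  disjoint : ∀ i j, i ≠ j → Disjoint (M i) (M j)
  null_compl : volume (U \ ⋃ i, M i) = 0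
  analytic : ∀ i, AnalyticOnNhd ℂ (A i) U
  distinct : ∀ i j, i ≠ j → ∃ z ∈ U, A i z ≠ A j z
  eqOn : ∀ i, EqOn Φ (A i) (M i)

end

open Filter Topology Metric
open scoped Convolution

/-! Near `p` the function Ψ agrees almost everywhere with a continuous `u`, because its derivative
is bounded, and each `2 * A i` has a holomorphic primitive `F i`, so that Re `F i` is harmonic with
∂/∂z equal to `A i`. It suffices that each Re `F i`, translated to touch `u` at a point of `M i`,
stays below `u` on a fixed disc (`SupportsOn`): these translates then have `u` as their maximum
(`isMaxAt_of_supportsOn`).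

Two mechanisms produce such support. If `A k p` is a vertex of the convex hull of the gradients
present, then `u` - Re `F k` is nondecreasing along an open cone of directions, and the maximum
principle forbids values below the one taken on `M k` (`eventually_supportsOn_of_exposed`). If `u`
is already a local maximum at every point of a punctured disc, one joins a point of `M i` to any
other point by a two-segment path that misses the centre and is bent so that no Re `F l` - Re `F i`
increases first and decreases later. A function that starts constant and is locally a maximum of
such branches cannot drop (`le_of_locally_isGreatest`, `exists_supportsOn_of_punctured`).

The two are combined by induction on the set of indices whose regions can accumulate at the point
(`eventually_isMaxAt`). Since no three gradients at `p` are collinear, either all of them are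
exposed, or at least three are (`forall_isExposedIn_or_exists_three`). In the second case a point
outside the closure of one of these three regions is covered by induction. A point in all three
closures is isolated among such points: support fixes three translation constants, hence the values
of two differences with independent gradients, and these separate points (`exists_eq_of_sub_eq`).
The punctured-disc argument then applies. -/

/-! ### Maxima of branches on an interval. -/

/-- A continuous function on `[0, 2]` which is locally a maximum of translates of functions that are
first strictly decreasing and then nondecreasing does not decrease, once it starts that way. -/
theorem le_of_locally_isGreatest {r : ℕ} {f : ℝ → ℝ} {G : Fin r → ℝ → ℝ}
    (hf : ContinuousOn f (Icc 0 2)) (hG : ∀ l, ContinuousOn (G l) (Icc 0 2))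
    (h0 : ∃ ε > 0, ∀ s ∈ Icc 0 ε, f s = f 0)
    (hloc : ∀ t ∈ Ioo (0 : ℝ) 2, ∃ c : Fin r → ℝ, ∀ᶠ s in 𝓝 t,
      IsGreatest (range fun l => G l s + c l) (f s))
    (hdir : ∀ l, ∀ t ∈ Ioo (0 : ℝ) 2, (∀ s ∈ Ico 0 t, G l t < G l s) ∨ MonotoneOn (G l) (Icc t 2)) :
    f 0 ≤ f 2 := by
  suffices H : Icc (0 : ℝ) 2 ⊆ {t | MonotoneOn f (Icc 0 t)} from
    H (right_mem_Icc.2 (by norm_num)) (by simp) (by simp) (by norm_num)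
  apply IsClosed.Icc_subset_of_forall_exists_gt
  · rw [← isSeqClosed_iff_isClosed]
    intro x t hx hxt
    have ht : t ∈ Icc (0 : ℝ) 2 := isClosed_Icc.mem_of_tendsto hxt (Eventually.of_forall fun n => (hx n).2)
    refine ⟨?_, ht⟩
    intro a ha b hb hab
    rcases hab.eq_or_lt with rfl | hab
    · exact le_rfl
    rcases hb.2.eq_or_lt with rfl | hbt
    · have hmin : Tendsto (fun n => f (min (x n) b)) atTop (𝓝 (f b)) := by
        refine (hf b ht).tendsto.comp (tendsto_nhdsWithin_iff.2 ⟨?_, ?_⟩)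
        · simpa using hxt.min (tendsto_const_nhds (x := b))
        · exact Eventually.of_forall fun n => ⟨le_min (hx n).2.1 ht.1, (min_le_right _ _).trans ht.2⟩
      refine ge_of_tendsto hmin ?_
      filter_upwards [hxt.eventually (lt_mem_nhds hab)] with n hn
      exact (hx n).1 ⟨ha.1, hn.le⟩ ⟨le_min (hx n).2.1 hb.1, min_le_left _ _⟩ (le_min hn.le hab.le)
    · obtain ⟨n, hn⟩ := (hxt.eventually (lt_mem_nhds hbt)).exists
      exact (hx n).1 ⟨ha.1, hab.le.trans hn.le⟩ ⟨hb.1, hn.le⟩ hab.le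
  · intro a ha b hb hab
    rw [le_antisymm ha.2 ha.1, le_antisymm hb.2 hb.1]
  · rintro t ⟨hmono, ht⟩ y hy
    rcases ht.1.eq_or_lt with rfl | htpos
    · obtain ⟨ε, hε, h⟩ := h0
      refine ⟨min ε y, fun a ha b hb _ => ?_, lt_min hε hy, min_le_right _ _⟩
      rw [h a ⟨ha.1, ha.2.trans (min_le_left _ _)⟩, h b ⟨hb.1, hb.2.trans (min_le_left _ _)⟩]
    obtain ⟨c, hc⟩ := hloc t ⟨htpos, ht.2⟩
    have hn : Icc (0 : ℝ) 2 ∈ 𝓝 t := Icc_mem_nhds htpos ht.2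
    have hft := (hf.continuousAt hn).tendsto
    have hGt := fun l => ((hG l).continuousAt hn).tendsto
    -- A branch touching `f` at `t` cannot have been strictly decreasing before `t`: it would have
    -- exceeded `f`, which is nondecreasing up to `t`.
    have hact : ∀ l, G l t + c l = f t → MonotoneOn (G l) (Icc t 2) := by
      intro l hl
      refine (hdir l t ⟨htpos, ht.2⟩).resolve_left fun hdec => ?_
      obtain ⟨ε, hε, hball⟩ := Metric.eventually_nhds_iff.1 hc
      set s := max 0 (t - ε / 2) with hs
      have hst : s < t := max_lt htpos (by linarith)
      have hs0 : 0 ≤ s := le_max_left _ _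
      have hd : dist s t < ε := by
        rw [Real.dist_eq, abs_sub_lt_iff]
        exact ⟨by linarith, by linarith [le_max_right 0 (t - ε / 2)]⟩
      have h1 := (hball hd).2 ⟨l, rfl⟩
      have h2 := hmono ⟨hs0, hst.le⟩ ⟨ht.1, le_rfl⟩ hst.le
      have h3 := hdec s ⟨hs0, hst⟩
      simp only at h1
      linarith
    -- Only branches that touch at `t` can attain the maximum near `t`, and by `hact` these are
    -- nondecreasing to the right.
    have hnear : ∀ᶠ s in 𝓝 t, ∀ l, G l s + c l = f s → G l t + c l = f t := by
      rw [eventually_all]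
      intro l
      by_cases hl : G l t + c l = f t
      · exact Eventually.of_forall fun _ _ => hl
      · have hlt : G l t + c l < f t := lt_of_le_of_ne (hc.self_of_nhds.2 ⟨l, rfl⟩) hl
        filter_upwards [((hGt l).add_const (c l)).eventually_lt hft hlt] with s hs h
        exact absurd h hs.ne
    obtain ⟨ε, hε, hball⟩ := Metric.eventually_nhds_iff.1 (hc.and hnear)
    set y' := min (min y 2) (t + ε / 2) with hy'
    have hty' : t < y' := lt_min (lt_min hy ht.2) (by linarith)
    have hy'2 : y' ≤ 2 := (min_le_left _ _).trans (min_le_right _ _)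
    refine ⟨y', ?_, hty', (min_le_left _ _).trans (min_le_left _ _)⟩
    have hright : MonotoneOn f (Icc t y') := by
      intro a ha b hb hab
      have hd : ∀ x ∈ Icc t y', dist x t < ε := by
        intro x hx
        rw [Real.dist_eq, abs_sub_lt_iff]
        constructor <;> linarith [hx.1, hx.2, min_le_right (min y 2) (t + ε / 2)]
      obtain ⟨l, hl⟩ := (hball (hd a ha)).1.1
      have h1 := hact l ((hball (hd a ha)).2 l hl) ⟨ha.1, ha.2.trans hy'2⟩ ⟨hb.1, hb.2.trans hy'2⟩ hab
      have h2 := (hball (hd b hb)).1.2 ⟨l, rfl⟩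
      simp only at hl h2
      linarith
    show MonotoneOn f (Icc 0 y')
    rw [← Icc_union_Icc_eq_Icc ht.1 hty'.le]
    exact hmono.union_right hright (isGreatest_Icc ht.1) (isLeast_Icc hty'.le)

/-! ### The local setting and the maximum principle. -/

/-- A family of holomorphic gradients near `p`, together with a continuous function `u` whose
gradient is one of them on a dense open set, in the form in which this information is used. -/
structure IsPiecewisePrimitive {r : ℕ} (p : ℂ) (ρ₀ : ℝ) (A F : Fin r → ℂ → ℂ) (M : Fin r → Set ℂ)
    (u : ℂ → ℝ) : Prop where
  pos : 0 < ρ₀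
  continuousOn : ∀ i, ContinuousOn (A i) (ball p ρ₀)
  hasDerivAt : ∀ i, ∀ w ∈ ball p ρ₀, HasDerivAt (F i) (2 * A i w) w
  isOpen : ∀ i, IsOpen (M i)
  disjoint : ∀ i j, i ≠ j → Disjoint (M i) (M j)
  continuous : Continuous u
  dense : ball p ρ₀ ⊆ closure (⋃ i, M i)
  mono : ∀ k z ρ d, ball z ρ ⊆ ball p ρ₀ →
    (∀ j, ∀ w ∈ M j, w ∈ ball z ρ → 0 ≤ (d * (A j w - A k w)).re) →
    ∀ a ∈ ball z ρ, a + d ∈ ball z ρ → u a - (F k a).re ≤ u (a + d) - (F k (a + d)).re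
  submean : ∀ c R, 0 < R → closedBall c R ⊆ ball p ρ₀ → u c ≤ Real.circleAverage u c R

namespace IsPiecewisePrimitive

variable {r : ℕ} {p : ℂ} {ρ₀ : ℝ} {A F : Fin r → ℂ → ℂ} {M : Fin r → Set ℂ} {u : ℂ → ℝ}

theorem exists_re_sub_eq (h : IsPiecewisePrimitive p ρ₀ A F M u) (i l : Fin r) {a b : ℂ}
    (ha : a ∈ ball p ρ₀) (hb : b ∈ ball p ρ₀) :
    ∃ w ∈ segment ℝ a b, ((F l b).re - (F i b).re) - ((F l a).re - (F i a).re)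
      = 2 * ((b - a) * (A l w - A i w)).re := by
  have key : ∀ x ∈ ball p ρ₀, HasFDerivWithinAt (fun w => (F l w).re - (F i w).re)
      (Complex.reCLM.comp (((2 * A l x - 2 * A i x) • (ContinuousLinearMap.id ℝ ℂ)))) (ball p ρ₀) x := by
    intro x hx
    have h1 := ((h.hasDerivAt l x hx).sub (h.hasDerivAt i x hx)).hasFDerivAt.restrictScalars ℝ
    have h2 := (Complex.reCLM.hasFDerivAt (x := F l x - F i x)).comp x h1
    refine (h2.congr_fderiv ?_).hasFDerivWithinAt
    ext v <;> simp [mul_comm]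
  obtain ⟨w, hw, he⟩ := domain_mvt key (convex_ball p ρ₀) ha hb
  refine ⟨w, hw, he.trans ?_⟩
  simp
  ring

theorem continuousOn_re (h : IsPiecewisePrimitive p ρ₀ A F M u) (i : Fin r) :
    ContinuousOn (fun w => (F i w).re) (ball p ρ₀) := fun w hw =>
  (Complex.continuous_re.continuousAt.comp (h.hasDerivAt i w hw).continuousAt).continuousWithinAt

theorem harmonicAt_re (h : IsPiecewisePrimitive p ρ₀ A F M u) (i : Fin r) {w : ℂ}
    (hw : w ∈ ball p ρ₀) : InnerProductSpace.HarmonicAt (fun w => (F i w).re) w := by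
  have : AnalyticAt ℂ (F i) w :=
    DifferentiableOn.analyticAt (s := ball p ρ₀)
      (fun x hx => (h.hasDerivAt i x hx).differentiableAt.differentiableWithinAt)
      (isOpen_ball.mem_nhds hw)
  exact this.harmonicAt_re

/-- Re `F i` is harmonic and so equals its circle averages; subtracting it preserves the sub-mean
value inequality. -/
theorem submean_sub (h : IsPiecewisePrimitive p ρ₀ A F M u) (i : Fin r) {c : ℂ} {R : ℝ} (hR : 0 < R)
    (hc : closedBall c R ⊆ ball p ρ₀) :
    u c - (F i c).re ≤ Real.circleAverage (fun w => u w - (F i w).re) c R := by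
  have h1 : Real.circleAverage (fun w => (F i w).re) c R = (F i c).re := by
    refine InnerProductSpace.HarmonicOnNhd.circleAverage_eq fun x hx => h.harmonicAt_re i (hc ?_)
    rwa [abs_of_pos hR] at hx
  have hs : sphere c |R| ⊆ ball p ρ₀ := by
    rw [abs_of_pos hR]; exact sphere_subset_closedBall.trans hc
  have h2 := Real.circleAverage_fun_sub (h.continuous.continuousOn.circleIntegrable' (c := c) (R := R))
    (((h.continuousOn_re i).mono hs).circleIntegrable')
  rw [h2, h1]
  linarith [h.submean c R hR hc]

end IsPiecewisePrimitive

/-- Strong maximum principle. -/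
theorem eqOn_of_submean_of_isPreconnected {v : ℂ → ℝ} {W C : Set ℂ} {m : ℝ} (hW : IsOpen W)
    (hv : ContinuousOn v W)
    (hsub : ∀ c R, 0 < R → closedBall c R ⊆ W → v c ≤ Real.circleAverage v c R)
    (hle : ∀ w ∈ W, v w ≤ m) (hC : IsPreconnected C) (hCW : C ⊆ W) {q : ℂ} (hq : q ∈ C)
    (hqm : v q = m) : ∀ w ∈ C, v w = m := by
  have hlt : IsOpen {w ∈ W | v w < m} := hv.isOpen_inter_preimage hW isOpen_Iio
  have heq : IsOpen {w ∈ W | v w = m} := by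
    rw [Metric.isOpen_iff]
    rintro c ⟨hcW, hcm⟩
    obtain ⟨ε, hε, hball⟩ := Metric.isOpen_iff.1 hW c hcW
    refine ⟨ε, hε, fun w hw => ⟨hball hw, ?_⟩⟩
    rcases eq_or_ne w c with rfl | hwc
    · exact hcm
    -- The circle about `c` is chosen through `w`: a value below `m` at `w` would, by continuity,
    -- push the average below `m` = `v c`.
    set R := dist w c
    have hR : 0 < R := dist_pos.2 hwc
    have hcl : closedBall c R ⊆ W := (closedBall_subset_ball hw).trans hball
    have hs : sphere c R ⊆ W := sphere_subset_closedBall.trans hcl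
    have hcont : Continuous fun θ => v (circleMap c R θ) := by
      refine hv.comp_continuous (continuous_circleMap c R) fun θ => hs (circleMap_mem_sphere c hR.le θ)
    by_contra hne
    have hwlt : v w < m := lt_of_le_of_ne (hle w (hball hw)) hne
    obtain ⟨θ, hθ, hθw⟩ : w ∈ circleMap c R '' Ioc 0 (2 * Real.pi) := by
      rw [image_circleMap_Ioc, abs_of_pos hR]
      exact mem_sphere.2 rfl
    have hav : Real.circleAverage v c R < m := by
      have h1 : ∫ θ in (0:ℝ)..2 * Real.pi, v (circleMap c R θ) < ∫ θ in (0:ℝ)..2 * Real.pi, m := by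
        refine intervalIntegral.integral_lt_integral_of_continuousOn_of_le_of_exists_lt
          Real.two_pi_pos hcont.continuousOn continuousOn_const
          (fun θ _ => hle _ (hs (circleMap_mem_sphere c hR.le θ))) ⟨θ, ⟨hθ.1.le, hθ.2⟩, by rw [hθw]; exact hwlt⟩
      rw [Real.circleAverage_def, smul_eq_mul, inv_mul_lt_iff₀ Real.two_pi_pos]
      simpa using h1
    linarith [hsub c R hR hcl]
  by_contra! hcon
  obtain ⟨w, hw, hwm⟩ := hcon
  obtain ⟨x, hx, h1, h2⟩ := hC _ _ heq hlt
    (fun x hx => by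
      rcases (hle x (hCW hx)).eq_or_lt with h | h
      · exact Or.inl ⟨hCW hx, h⟩
      · exact Or.inr ⟨hCW hx, h⟩)
    ⟨q, hq, hCW hq, hqm⟩ ⟨w, hw, hCW hw, lt_of_le_of_ne (hle w (hCW hw)) hwm⟩
  exact absurd h1.2 h2.2.ne

/-! ### Supporting functions and exposed gradients. -/

/-- On `s`, the graph of `u` lies above the translates of `Re F` that touch it at points of `M`. -/
def SupportsOn (F : ℂ → ℂ) (M : Set ℂ) (u : ℂ → ℝ) (s : Set ℂ) : Prop :=
  ∀ q ∈ M, q ∈ s → ∀ y ∈ s, u q - (F q).re ≤ u y - (F y).re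

/-- Near `z`, the function `u` is the maximum of translates of the functions `Re (F i)`. -/
def IsMaxAt {r : ℕ} (F : Fin r → ℂ → ℂ) (u : ℂ → ℝ) (z : ℂ) : Prop :=
  ∃ c : Fin r → ℝ, ∀ᶠ w in 𝓝 z, IsGreatest (range fun i => (F i w).re + c i) (u w)

theorem SupportsOn.mono {F : ℂ → ℂ} {M : Set ℂ} {u : ℂ → ℝ} {s t : Set ℂ} (h : SupportsOn F M u t)
    (hst : s ⊆ t) : SupportsOn F M u s :=
  fun q hq hqs y hy => h q hq (hst hqs) y (hst hy)

namespace IsPiecewisePrimitive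

variable {r : ℕ} {p : ℂ} {ρ₀ : ℝ} {A F : Fin r → ℂ → ℂ} {M : Fin r → Set ℂ} {u : ℂ → ℝ}

/-- Near a point of `M k` no other gradient occurs, so the monotonicity hypothesis holds with
equality for every direction and can be used for both `d` and `-d`. -/
theorem eventually_sub_eq (h : IsPiecewisePrimitive p ρ₀ A F M u) {k : Fin r} {q : ℂ} (hq : q ∈ M k)
    (hqp : q ∈ ball p ρ₀) : ∀ᶠ b in 𝓝 q, u b - (F k b).re = u q - (F k q).re := by
  obtain ⟨ε, hε, hball⟩ := Metric.isOpen_iff.1 ((h.isOpen k).inter isOpen_ball) q ⟨hq, hqp⟩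
  have hsub : ball q ε ⊆ ball p ρ₀ := fun w hw => (hball hw).2
  have hd : ∀ d : ℂ, ∀ j, ∀ w ∈ M j, w ∈ ball q ε → 0 ≤ (d * (A j w - A k w)).re := by
    intro d j w hw hwb
    have : j = k := by
      by_contra hjk
      exact Set.disjoint_left.1 (h.disjoint j k hjk) hw (hball hwb).1
    simp [this]
  filter_upwards [ball_mem_nhds q hε] with b hb
  apply le_antisymm
  · simpa using h.mono k q ε (q - b) hsub (hd _) b hb (by simpa using hε)
  · simpa using h.mono k q ε (b - q) hsub (hd _) q (mem_ball_self hε) (by simpa using hb)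

/-- If every gradient supports `u` on a disc, then `u` is a maximum near its centre. The functions
whose gradient does not occur in the disc are translated to lie below `u`. -/
theorem isMaxAt_of_supportsOn (h : IsPiecewisePrimitive p ρ₀ A F M u) {z : ℂ} (hz : z ∈ ball p ρ₀)
    {ρ : ℝ} (hρ : 0 < ρ) (hs : ∀ i, SupportsOn (F i) (M i) u (ball z ρ)) : IsMaxAt F u z := by
  classical
  obtain ⟨ε, hε, hball⟩ := Metric.isOpen_iff.1 (isOpen_ball.inter (isOpen_ball (x := z) (ε := ρ))) z
    ⟨hz, mem_ball_self hρ⟩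
  have hsub : ball z ε ⊆ ball p ρ₀ := fun w hw => (hball hw).1
  replace hs := fun i => (hs i).mono fun w hw => (hball hw).2
  have hc : ∀ i, ∃ c : ℝ, (∀ q ∈ M i, q ∈ ball z ε → u q - (F i q).re = c) ∧
      ∀ᶠ w in 𝓝 z, (F i w).re + c ≤ u w := by
    intro i
    by_cases hi : ∃ q ∈ M i, q ∈ ball z ε
    · obtain ⟨q, hq, hqz⟩ := hi
      refine ⟨u q - (F i q).re, fun q' hq' hqz' => ?_, ?_⟩
      · exact le_antisymm (hs i q' hq' hqz' q hqz) (hs i q hq hqz q' hqz')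
      · filter_upwards [ball_mem_nhds z hε] with w hw
        linarith [hs i q hq hqz w hw]
    · push Not at hi
      -- Any constant making the branch strictly smaller than `u` at `z` would do; continuity keeps
      -- it below `u` nearby.
      refine ⟨u z - (F i z).re - 1, fun q hq hqz => absurd hqz (hi q hq), ?_⟩
      have h1 := ((h.continuousOn_re i).continuousAt (isOpen_ball.mem_nhds hz)).tendsto.add_const
        (u z - (F i z).re - 1)
      filter_upwards [h1.eventually_lt (h.continuous.tendsto z) (by linarith)] with w hw
      exact hw.le
  choose c hc1 hc2 using hc
  refine ⟨c, ?_⟩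
  filter_upwards [eventually_all.2 hc2, ball_mem_nhds z hε] with w hw hwz
  refine ⟨?_, by rintro _ ⟨i, rfl⟩; exact hw i⟩
  -- If no branch meets `u` at `w`, none does near `w`; but points of the regions are dense, and
  -- there the branch of the region does meet `u`.
  by_contra hcon
  have hne : ∀ i, ∀ᶠ w' in 𝓝 w, (F i w').re + c i ≠ u w' := by
    intro i
    have h1 := ((h.continuousOn_re i).continuousAt (isOpen_ball.mem_nhds (hsub hwz))).tendsto.add_const
      (c i)
    have h2 := (h1.sub (h.continuous.tendsto w)).eventually_ne
      (sub_ne_zero.2 fun he => hcon ⟨i, he⟩)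
    exact h2.mono fun w' hw' => sub_ne_zero.1 hw'
  obtain ⟨w', hw', hne', hb'⟩ := (mem_closure_iff_frequently.1 (h.dense (hsub hwz))).and_eventually
    ((eventually_all.2 hne).and (isOpen_ball.mem_nhds hwz)) |>.exists
  obtain ⟨i, hi⟩ := mem_iUnion.1 hw'
  exact hne' i (by linarith [hc1 i w' hi hb'])

theorem exists_ball_disjoint {z : ℂ} {V : Set ℂ} (hV : V ∈ 𝓝 z) {S : Finset (Fin r)}
    (hS : ∀ j ∉ S, z ∉ closure (M j)) :
    ∃ ρ > 0, ball z ρ ⊆ V ∧ ∀ j ∉ S, ∀ w ∈ M j, w ∉ ball z ρ := by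
  have h1 : ∀ᶠ w in 𝓝 z, ∀ j, j ∉ S → w ∉ closure (M j) := by
    rw [eventually_all]
    intro j
    by_cases hj : j ∈ S
    · exact Eventually.of_forall fun _ h => absurd hj h
    · filter_upwards [isClosed_closure.isOpen_compl.mem_nhds (hS j hj)] with w hw _ using hw
  obtain ⟨ρ, hρ, hball⟩ := Metric.mem_nhds_iff.1 (inter_mem hV h1)
  exact ⟨ρ, hρ, fun w hw => (hball hw).1, fun j hj w hw hwz => (hball hwz).2 j hj (subset_closure hw)⟩

theorem continuousAt_coeff (h : IsPiecewisePrimitive p ρ₀ A F M u) (i : Fin r) :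
    ContinuousAt (A i) p :=
  (h.continuousOn i).continuousAt (ball_mem_nhds p h.pos)

/-- A gradient which is exposed by some direction among those present supports `u` locally. -/
theorem eventually_supportsOn_of_exposed (h : IsPiecewisePrimitive p ρ₀ A F M u) {k : Fin r}
    {S : Finset (Fin r)} (he : ∃ e : ℂ, ∀ j ∈ S, j ≠ k → 0 < (e * (A j p - A k p)).re) :
    ∀ᶠ z in 𝓝 p, (∀ j ∉ S, z ∉ closure (M j)) →
      ∃ ρ > 0, SupportsOn (F k) (M k) u (ball z ρ) := by
  obtain ⟨e, he0, he⟩ : ∃ e : ℂ, e ≠ 0 ∧ ∀ j ∈ S, j ≠ k → 0 < (e * (A j p - A k p)).re := by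
    obtain ⟨e, he⟩ := he
    rcases eq_or_ne e 0 with rfl | h0
    · exact ⟨1, one_ne_zero, fun j hj hjk => absurd (he j hj hjk) (by simp)⟩
    · exact ⟨e, h0, he⟩
  have hev : ∀ᶠ x : ℂ × ℂ in 𝓝 (e, p), ∀ j, j ∈ S → j ≠ k →
      0 < (x.1 * (A j x.2 - A k x.2)).re := by
    rw [eventually_all]
    intro j
    by_cases hj : j ∈ S ∧ j ≠ k
    · have hc : ContinuousAt (fun x : ℂ × ℂ => (x.1 * (A j x.2 - A k x.2)).re) (e, p) := by
        have h1 : ContinuousAt (fun x : ℂ × ℂ => A j x.2) (e, p) :=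
          ContinuousAt.comp (f := Prod.snd) (x := (e, p)) (h.continuousAt_coeff j) continuousAt_snd
        have h2 : ContinuousAt (fun x : ℂ × ℂ => A k x.2) (e, p) :=
          ContinuousAt.comp (f := Prod.snd) (x := (e, p)) (h.continuousAt_coeff k) continuousAt_snd
        exact Complex.continuous_re.continuousAt.comp (continuousAt_fst.mul (h1.sub h2))
      filter_upwards [hc.eventually (lt_mem_nhds (he j hj.1 hj.2))] with x hx _ _ using hx
    · exact Eventually.of_forall fun x h1 h2 => absurd ⟨h1, h2⟩ hj
  obtain ⟨η, hη, hball⟩ := Metric.eventually_nhds_iff_ball.1 hev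
  have hcone : ∀ e' ∈ ball e η, ∀ w ∈ ball p η, ∀ j ∈ S, j ≠ k →
      0 < (e' * (A j w - A k w)).re := fun e' he' w hw j hj hjk =>
    hball (e', w) (by rw [← ball_prod_same]; exact ⟨he', hw⟩) j hj hjk
  filter_upwards [ball_mem_nhds p hη, ball_mem_nhds p h.pos] with z hzη hz0 hS
  obtain ⟨ρ, hρ, hρV, hρS⟩ := exists_ball_disjoint
    (inter_mem (isOpen_ball.mem_nhds hzη) (isOpen_ball.mem_nhds hz0)) hS
  have hsub : ball z ρ ⊆ ball p ρ₀ := fun w hw => (hρV hw).2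
  set v : ℂ → ℝ := fun w => u w - (F k w).re with hv
  have hvc : ContinuousOn v (ball p ρ₀) := h.continuous.continuousOn.sub (h.continuousOn_re k)
  have hmono : ∀ a ∈ ball z ρ, ∀ b ∈ ball z ρ, ∀ t : ℝ, 0 < t → (b - a) / t ∈ ball e η →
      v a ≤ v b := by
    intro a ha b hb t ht hab
    have := h.mono k z ρ (b - a) hsub (fun j w hw hwz => ?_) a ha (by simpa using hb)
    · rwa [add_sub_cancel] at this
    by_cases hjS : j ∈ S
    · by_cases hjk : j = k
      · simp [hjk]
      · have h1 := hcone _ hab w (hρV hwz).1 j hjS hjk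
        have h2 : (b - a) * (A j w - A k w) = (t : ℂ) * ((b - a) / t * (A j w - A k w)) := by
          have : (t : ℂ) ≠ 0 := by exact_mod_cast ht.ne'
          field_simp
        rw [h2, Complex.re_ofReal_mul]
        positivity
    · exact absurd hwz (hρS j hjS w hw)
  have hen : 0 < ‖e‖ := norm_pos_iff.2 he0
  set σ : ℝ := ρ / (2 * ‖e‖) with hσ
  have hσ0 : 0 < σ := by positivity
  have hσC : (σ : ℂ) ≠ 0 := by exact_mod_cast hσ0.ne'
  -- A base point at distance `ρ / 2` behind `z`, common to all the segments used below.
  set x : ℂ := z - σ * e with hx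
  have hxz : x ∈ ball z ρ := by
    rw [mem_ball_iff_norm, hx, sub_sub_cancel_left, norm_neg, norm_mul, Complex.norm_real,
      Real.norm_of_nonneg hσ0.le, hσ]
    field_simp
    norm_num
  -- For `q` within `σ * η` of `z`, the vector `(q - x) / σ` is within `η` of `e`, so the direction
  -- from `x` to `q` lies in the cone.
  set ρ' := min ρ (σ * η) with hρ'
  have hρ'0 : 0 < ρ' := by positivity
  refine ⟨ρ', hρ'0, fun q hq hqz y hyz => ?_⟩
  have hin : ∀ q ∈ ball z ρ', q ∈ ball z ρ := fun q hq => ball_subset_ball (min_le_left _ _) hq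
  have hseg : ∀ q ∈ ball z ρ', ∀ m, v q ≤ m → ∀ a ∈ segment ℝ q x, a ≠ q →
      ∀ᶠ a' in 𝓝 a, v a' ≤ m := by
    intro q hq m hm a ha haq
    have haz : a ∈ ball z ρ := (convex_ball z ρ).segment_subset (hin q hq) hxz ha
    rw [segment_eq_image'] at ha
    obtain ⟨t, ht, rfl⟩ := ha
    have ht0 : 0 < t := lt_of_le_of_ne ht.1 fun h0 => haq (by simp [← h0])
    have htC : (t : ℂ) ≠ 0 := by exact_mod_cast ht0.ne'
    have hmem : (q - (q + t • (x - q))) / ((t * σ : ℝ) : ℂ) ∈ ball e η := by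
      have h1 : (q - (q + t • (x - q))) / ((t * σ : ℝ) : ℂ) - e = (q - z) / σ := by
        rw [Complex.real_smul, hx]
        push_cast
        field_simp
        ring
      rw [mem_ball_iff_norm, h1, norm_div, Complex.norm_real, Real.norm_of_nonneg hσ0.le,
        div_lt_iff₀ hσ0, mul_comm]
      exact (mem_ball_iff_norm.1 hq).trans_le (min_le_right _ _)
    have hcont : Continuous fun a' : ℂ => (q - a') / ((t * σ : ℝ) : ℂ) := by fun_prop
    filter_upwards [isOpen_ball.mem_nhds haz,
      hcont.continuousAt.eventually (isOpen_ball.mem_nhds hmem)] with a' h1 h2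
    exact (hmono a' h1 q (hin q hq) (t * σ) (by positivity) h2).trans hm
  by_contra! hlt
  change v y < v q at hlt
  -- The interior of the sublevel set of `v q` in the disc. It contains `q`, where `v` is locally
  -- constant, `y`, where `v` is strictly smaller, and both segments to `x`, by the cone. The
  -- maximum principle then forces `v y = v q`.
  set W : Set ℂ := ball z ρ ∩ {a | ∀ᶠ a' in 𝓝 a, v a' ≤ v q} with hW
  have hWo : IsOpen W := isOpen_ball.inter isOpen_setOfPred_eventually_nhds
  have hWsub : W ⊆ ball p ρ₀ := fun w hw => hsub hw.1
  have hqW : ∀ᶠ a' in 𝓝 q, v a' ≤ v q := by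
    filter_upwards [h.eventually_sub_eq hq (hsub (hin q hqz))] with a' ha' using ha'.le
  have hyW : ∀ᶠ a' in 𝓝 y, v a' ≤ v q := by
    filter_upwards [(hvc.continuousAt (isOpen_ball.mem_nhds (hsub (hin y hyz)))).eventually
      (gt_mem_nhds hlt)] with a' ha' using ha'.le
  have hCW : segment ℝ q x ∪ segment ℝ y x ⊆ W := by
    rintro a (ha | ha)
    · refine ⟨(convex_ball z ρ).segment_subset (hin q hqz) hxz ha, ?_⟩
      rcases eq_or_ne a q with rfl | haq
      · exact hqW
      · exact hseg q hqz _ le_rfl a ha haq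
    · refine ⟨(convex_ball z ρ).segment_subset (hin y hyz) hxz ha, ?_⟩
      rcases eq_or_ne a y with rfl | haq
      · exact hyW
      · exact hseg y hyz _ hlt.le a ha haq
  have hC : IsPreconnected (segment ℝ q x ∪ segment ℝ y x) :=
    IsPreconnected.union x (right_mem_segment ℝ q x) (right_mem_segment ℝ y x)
      (convex_segment q x).isPreconnected (convex_segment y x).isPreconnected
  exact hlt.ne (eqOn_of_submean_of_isPreconnected hWo (hvc.mono hWsub)
    (fun c R hR hc => h.submean_sub k hR (hc.trans hWsub)) (fun w hw => hw.2.self_of_nhds) hC hCW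
    (Or.inl (left_mem_segment ℝ q x)) rfl y (Or.inr (left_mem_segment ℝ y x)))

end IsPiecewisePrimitive

/-! ### Exposed points of a finite plane set. -/

/-- The point `a k` is strictly separated from the points `a j`, `j ∈ S`, by a linear form. -/
def IsExposedIn {r : ℕ} (a : Fin r → ℂ) (S : Finset (Fin r)) (k : Fin r) : Prop :=
  ∃ e : ℂ, ∀ j ∈ S, j ≠ k → 0 < (e * (a j - a k)).re

theorem isExposedIn_of_notMem_convexHull {r : ℕ} {a : Fin r → ℂ} {S : Finset (Fin r)} {k : Fin r}
    (h : a k ∉ convexHull ℝ (a '' {j | j ∈ S ∧ j ≠ k})) : IsExposedIn a S k := by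
  have hfin : (a '' {j | j ∈ S ∧ j ≠ k}).Finite := (Set.toFinite _).image a
  obtain ⟨f, s, h1, h2⟩ := geometric_hahn_banach_point_closed (convex_convexHull ℝ _)
    (hfin.isCompact_convexHull (𝕜 := ℝ)).isClosed h
  -- Every real-linear form on the plane is Re of multiplication by a complex number, here this one.
  refine ⟨(f 1 : ℂ) - f Complex.I * Complex.I, fun j hj hjk => ?_⟩
  have h3 := h2 (a j) (subset_convexHull ℝ _ ⟨j, ⟨hj, hjk⟩, rfl⟩)
  have hf : ∀ w : ℂ, (((f 1 : ℂ) - f Complex.I * Complex.I) * w).re = f w := by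
    intro w
    conv_rhs => rw [← Complex.re_add_im w, mul_comm (w.im : ℂ)]
    have e1 : (w.re : ℂ) = w.re • (1 : ℂ) := by simp
    have e2 : Complex.I * (w.im : ℂ) = w.im • Complex.I := by simp [mul_comm]
    rw [map_add, e1, e2, map_smul, map_smul]
    simp
    ring
  rw [hf, map_sub]
  linarith

/-- A finite set of points in the plane, no three collinear, has all points exposed, or at least
three of them. -/
theorem forall_isExposedIn_or_exists_three {r : ℕ} {a : Fin r → ℂ}
    (h2 : ∀ i j k, i ≠ j → j ≠ k → i ≠ k → ∀ t : ℝ, a i - a k ≠ t * (a j - a k))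
    (h3 : ∀ i k, i ≠ k → a i ≠ a k) (S : Finset (Fin r)) :
    (∀ k ∈ S, IsExposedIn a S k) ∨ ∃ k₁ ∈ S, ∃ k₂ ∈ S, ∃ k₃ ∈ S, k₁ ≠ k₂ ∧ k₁ ≠ k₃ ∧ k₂ ≠ k₃ ∧
      IsExposedIn a S k₁ ∧ IsExposedIn a S k₂ ∧ IsExposedIn a S k₃ := by
  classical
  by_contra! hcon
  obtain ⟨⟨i, hiS, hi⟩, hthree⟩ := hcon
  set E := S.filter fun k => IsExposedIn a S k with hE
  set X := a '' (S : Set (Fin r)) with hX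
  have hXfin : X.Finite := S.finite_toSet.image a
  have hcomp : IsCompact (convexHull ℝ X) := hXfin.isCompact_convexHull (𝕜 := ℝ)
  -- An extreme point is not in the hull of the remaining points, hence is exposed; by Krein–Milman
  -- the exposed points span the whole hull.
  have hext : (convexHull ℝ X).extremePoints ℝ ⊆ a '' (E : Set (Fin r)) := by
    intro x hx
    obtain ⟨k, hk, rfl⟩ := extremePoints_convexHull_subset hx
    refine ⟨k, ?_, rfl⟩
    simp only [hE, Finset.coe_filter, mem_ofPred_eq]
    refine ⟨hk, isExposedIn_of_notMem_convexHull fun hmem => ?_⟩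
    have := ((convex_convexHull ℝ X).mem_extremePoints_iff_mem_sdiff_convexHull_sdiff.1 hx).2
    refine this (convexHull_mono ?_ hmem)
    rintro _ ⟨j, ⟨hj, hjk⟩, rfl⟩
    exact ⟨subset_convexHull ℝ X ⟨j, hj, rfl⟩, h3 j k hjk⟩
  have hmem : a i ∈ convexHull ℝ (a '' (E : Set (Fin r))) := by
    have h1 := closure_convexHull_extremePoints hcomp (convex_convexHull ℝ X)
    have h2 : a i ∈ convexHull ℝ X := subset_convexHull ℝ X ⟨i, hiS, rfl⟩
    rw [← h1] at h2
    have hcl : IsClosed (convexHull ℝ (a '' (E : Set (Fin r)))) :=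
      ((E.finite_toSet.image a).isCompact_convexHull (𝕜 := ℝ)).isClosed
    exact closure_minimal (convexHull_mono hext) hcl h2
  have hiE : i ∉ E := fun h => hi (Finset.mem_filter.1 h).2
  have hcard : E.card ≤ 2 := by
    by_contra! hc
    obtain ⟨k₁, m1, k₂, m2, k₃, m3, n1, n2, n3⟩ := Finset.two_lt_card.1 hc
    rw [hE, Finset.mem_filter] at m1 m2 m3
    exact hthree k₁ m1.1 k₂ m2.1 k₃ m3.1 n1 n2 n3 m1.2 m2.2 m3.2
  -- With at most two exposed points the hull is empty, a point or a segment, which leaves no room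
  -- for the unexposed `a i`.
  interval_cases hc : E.card
  · rw [Finset.card_eq_zero] at hc
    simp [hc] at hmem
  · obtain ⟨k, hk⟩ := Finset.card_eq_one.1 hc
    rw [hk] at hmem hiE
    simp only [Finset.coe_singleton, image_singleton, convexHull_singleton, mem_singleton_iff] at hmem
    exact h3 i k (by simpa using hiE) hmem
  · obtain ⟨k, k', hkk, hk⟩ := Finset.card_eq_two.1 hc
    rw [hk] at hmem hiE
    simp only [Finset.coe_insert, Finset.coe_singleton, image_pair, convexHull_pair] at hmem
    rw [segment_eq_image'] at hmem
    obtain ⟨t, -, ht⟩ := hmem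
    simp only [Finset.mem_insert, Finset.mem_singleton, not_or] at hiE
    refine h2 i k' k hiE.2 hkk.symm hiE.1 t ?_
    rw [← ht]
    simp

/-! ### Bent paths. -/

/-- Perturbing the direction `d` to the successive directions `d / 2 + τ` and `d / 2 - τ`, none of the
linear forms `b l` vanishes on them, and none is positive first and negative later. -/
theorem exists_bend {r : ℕ} {b : Fin r → ℂ} {i : Fin r} (h0 : ∀ l, l ≠ i → b l ≠ 0)
    (h2 : ∀ l j, l ≠ i → j ≠ i → l ≠ j → ∀ t : ℝ, b l ≠ t * b j) {d : ℂ} (hd : d ≠ 0) :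
    ∃ τ : ℂ, ‖τ‖ < 1 ∧ ∀ l, l ≠ i → ((d / 2 + τ) * b l).re ≠ 0 ∧ ((d / 2 - τ) * b l).re ≠ 0 ∧
      (((d / 2 + τ) * b l).re < 0 ∨ 0 < ((d / 2 - τ) * b l).re) := by
  -- Two forms vanishing on the same `d` would be parallel, so at most one does; `β` is that form,
  -- or 0 if there is none.
  obtain ⟨β, hβ⟩ : ∃ β : ℂ, ∀ l, l ≠ i → (d * b l).re ≠ 0 ∨ b l = β := by
    by_cases hj : ∃ j, j ≠ i ∧ (d * b j).re = 0
    · obtain ⟨j, hji, hj⟩ := hj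
      refine ⟨b j, fun l hl => ?_⟩
      rcases eq_or_ne l j with rfl | hlj
      · exact Or.inr rfl
      refine Or.inl fun hl0 => h2 l j hl hji hlj ((d * b l).im / (d * b j).im) ?_
      have hn : (d * b j).im ≠ 0 := fun h =>
        mul_ne_zero hd (h0 j hji) (Complex.ext hj h)
      apply mul_left_cancel₀ hd
      rw [mul_left_comm]
      apply Complex.ext
      · rw [Complex.re_ofReal_mul, hj, hl0, mul_zero]
      · rw [Complex.im_ofReal_mul, div_mul_cancel₀ _ hn]
    · push Not at hj
      exact ⟨0, fun l hl => Or.inl (hj l hl)⟩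
  -- The bend is `τ = -s * conj β` with small `s > 0`. The form `β` becomes negative first and
  -- positive later; every other form keeps on both pieces the sign it has on `d`.
  have hnorm : ∀ᶠ s : ℝ in 𝓝[>] 0, ‖-(s : ℂ) * starRingEnd ℂ β‖ < 1 := by
    have hc : Continuous fun s : ℝ => ‖-(s : ℂ) * starRingEnd ℂ β‖ := by fun_prop
    exact (hc.continuousAt.eventually (gt_mem_nhds (by simp))).filter_mono nhdsWithin_le_nhds
  have hall : ∀ᶠ s : ℝ in 𝓝[>] 0, ∀ l, l ≠ i →
      ((d / 2 + -(s : ℂ) * starRingEnd ℂ β) * b l).re ≠ 0 ∧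
      ((d / 2 - -(s : ℂ) * starRingEnd ℂ β) * b l).re ≠ 0 ∧
      (((d / 2 + -(s : ℂ) * starRingEnd ℂ β) * b l).re < 0 ∨
        0 < ((d / 2 - -(s : ℂ) * starRingEnd ℂ β) * b l).re) := by
    rw [eventually_all]
    intro l
    by_cases hl : l = i
    · exact Eventually.of_forall fun _ h => absurd hl h
    by_cases hre : (d * b l).re = 0
    · have hlβ : b l = β := (hβ l hl).resolve_left fun h => h hre
      filter_upwards [self_mem_nhdsWithin] with s hs _
      have hpos : 0 < s * Complex.normSq (b l) := mul_pos hs (Complex.normSq_pos.2 (h0 l hl))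
      have hm : starRingEnd ℂ (b l) * b l = (Complex.normSq (b l) : ℂ) :=
        (Complex.normSq_eq_conj_mul_self).symm
      have e1 : ((d / 2 + -(s : ℂ) * starRingEnd ℂ β) * b l).re = -(s * Complex.normSq (b l)) := by
        rw [← hlβ, add_mul, mul_assoc (-(s : ℂ)), hm, div_mul_eq_mul_div, Complex.add_re,
          Complex.div_ofNat_re, hre]
        simp
      have e2 : ((d / 2 - -(s : ℂ) * starRingEnd ℂ β) * b l).re = s * Complex.normSq (b l) := by
        rw [← hlβ, sub_mul, mul_assoc (-(s : ℂ)), hm, div_mul_eq_mul_div, Complex.sub_re,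
          Complex.div_ofNat_re, hre]
        simp
      rw [e1, e2]
      exact ⟨by linarith, hpos.ne', Or.inr hpos⟩
    · have hsq : 0 < (d * b l).re * (d / 2 * b l).re := by
        rw [div_mul_eq_mul_div, Complex.div_ofNat_re]
        rw [mul_div_assoc']
        exact div_pos (mul_self_pos.2 hre) two_pos
      have c1 : Continuous fun s : ℝ =>
          (d * b l).re * ((d / 2 + -(s : ℂ) * starRingEnd ℂ β) * b l).re := by fun_prop
      have c2 : Continuous fun s : ℝ =>
          (d * b l).re * ((d / 2 - -(s : ℂ) * starRingEnd ℂ β) * b l).re := by fun_prop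
      have v1 := (c1.continuousAt (x := 0)).eventually (lt_mem_nhds (a := 0) (by simpa using hsq))
      have v2 := (c2.continuousAt (x := 0)).eventually (lt_mem_nhds (a := 0) (by simpa using hsq))
      filter_upwards [v1.filter_mono nhdsWithin_le_nhds, v2.filter_mono nhdsWithin_le_nhds]
        with s w1 w2 _
      refine ⟨right_ne_zero_of_mul w1.ne', right_ne_zero_of_mul w2.ne', ?_⟩
      rcases lt_or_gt_of_ne hre with hneg | hpos
      · exact Or.inl (by nlinarith)
      · exact Or.inr (pos_of_mul_pos_right w2 hpos.le)
  obtain ⟨s, h1, h2⟩ := (hnorm.and hall).exists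
  exact ⟨_, h1, h2⟩

/-- A uniform version of `exists_bend` for continuous families of linear forms. -/
theorem exists_uniform_bend {r : ℕ} {b : Fin r → ℂ → ℂ} {i : Fin r} {p : ℂ}
    (hb : ∀ l, ContinuousAt (b l) p) (h0 : ∀ l, l ≠ i → b l p ≠ 0)
    (h2 : ∀ l j, l ≠ i → j ≠ i → l ≠ j → ∀ t : ℝ, b l p ≠ t * b j p) :
    ∃ δ > 0, ∀ d ∈ sphere (0 : ℂ) 1, ∃ τ : ℂ, ∃ ε > 0, ∀ τ' ∈ ball τ ε, ‖τ'‖ < 1 ∧ ∀ l, l ≠ i →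
      ∃ s₁ s₂ : ℝ, (s₁ < 0 ∨ 0 < s₂) ∧ ∀ w ∈ ball p δ,
        0 < s₁ * ((d / 2 + τ') * b l w).re ∧ 0 < s₂ * ((d / 2 - τ') * b l w).re := by
  -- Compactness of the circle of directions makes `δ` independent of `d`.
  refine (isCompact_sphere (0 : ℂ) 1).induction_on (p := fun s => ∃ δ > 0, ∀ d ∈ s, ∃ τ : ℂ, ∃ ε > 0,
    ∀ τ' ∈ ball τ ε, ‖τ'‖ < 1 ∧ ∀ l, l ≠ i →
      ∃ s₁ s₂ : ℝ, (s₁ < 0 ∨ 0 < s₂) ∧ ∀ w ∈ ball p δ,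
        0 < s₁ * ((d / 2 + τ') * b l w).re ∧ 0 < s₂ * ((d / 2 - τ') * b l w).re) ?_ ?_ ?_ ?_
  · exact ⟨1, one_pos, by simp⟩
  · rintro s t hst ⟨δ, hδ, h⟩
    exact ⟨δ, hδ, fun d hd => h d (hst hd)⟩
  · rintro s t ⟨δ, hδ, h⟩ ⟨δ', hδ', h'⟩
    refine ⟨min δ δ', lt_min hδ hδ', ?_⟩
    rintro d (hd | hd)
    · obtain ⟨τ, ε, hε, H⟩ := h d hd
      refine ⟨τ, ε, hε, fun τ' hτ' => ⟨(H τ' hτ').1, fun l hl => ?_⟩⟩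
      obtain ⟨s₁, s₂, hs, hw⟩ := (H τ' hτ').2 l hl
      exact ⟨s₁, s₂, hs, fun w hwb => hw w (ball_subset_ball (min_le_left _ _) hwb)⟩
    · obtain ⟨τ, ε, hε, H⟩ := h' d hd
      refine ⟨τ, ε, hε, fun τ' hτ' => ⟨(H τ' hτ').1, fun l hl => ?_⟩⟩
      obtain ⟨s₁, s₂, hs, hw⟩ := (H τ' hτ').2 l hl
      exact ⟨s₁, s₂, hs, fun w hwb => hw w (ball_subset_ball (min_le_right _ _) hwb)⟩
  · intro d hd
    have hd0 : d ≠ 0 := by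
      rintro rfl
      simp at hd
    obtain ⟨τ, hτ, H⟩ := exists_bend h0 h2 hd0
    have hev : ∀ᶠ x : ℂ × ℂ × ℂ in 𝓝 (d, τ, p), ‖x.2.1‖ < 1 ∧ ∀ l, l ≠ i →
        0 < ((d / 2 + τ) * b l p).re * ((x.1 / 2 + x.2.1) * b l x.2.2).re ∧
        0 < ((d / 2 - τ) * b l p).re * ((x.1 / 2 - x.2.1) * b l x.2.2).re := by
      refine Eventually.and ?_ (eventually_all.2 fun l => ?_)
      · have : Continuous fun x : ℂ × ℂ × ℂ => ‖x.2.1‖ := by fun_prop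
        exact this.continuousAt.eventually (gt_mem_nhds hτ)
      · by_cases hl : l = i
        · exact Eventually.of_forall fun _ h => absurd hl h
        have hbl : ContinuousAt (fun x : ℂ × ℂ × ℂ => b l x.2.2) (d, τ, p) :=
          ContinuousAt.comp (f := fun x : ℂ × ℂ × ℂ => x.2.2) (x := (d, τ, p)) (hb l)
            (by fun_prop)
        have c1 : ContinuousAt (fun x : ℂ × ℂ × ℂ =>
            ((d / 2 + τ) * b l p).re * ((x.1 / 2 + x.2.1) * b l x.2.2).re) (d, τ, p) :=
          continuousAt_const.mul (Complex.continuous_re.continuousAt.comp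
            (ContinuousAt.mul (by fun_prop) hbl))
        have c2 : ContinuousAt (fun x : ℂ × ℂ × ℂ =>
            ((d / 2 - τ) * b l p).re * ((x.1 / 2 - x.2.1) * b l x.2.2).re) (d, τ, p) :=
          continuousAt_const.mul (Complex.continuous_re.continuousAt.comp
            (ContinuousAt.mul (by fun_prop) hbl))
        obtain ⟨n1, n2, -⟩ := H l hl
        filter_upwards [c1.eventually (lt_mem_nhds (mul_self_pos.2 n1)),
          c2.eventually (lt_mem_nhds (mul_self_pos.2 n2))] with x h1 h2 _ using ⟨h1, h2⟩
    obtain ⟨ε, hε, hball⟩ := Metric.eventually_nhds_iff_ball.1 hev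
    refine ⟨ball d ε, mem_nhdsWithin_of_mem_nhds (ball_mem_nhds d hε), ε, hε, fun d' hd' =>
      ⟨τ, ε, hε, fun τ' hτ' => ?_⟩⟩
    have hmem : ∀ w ∈ ball p ε, (d', τ', w) ∈ ball (d, τ, p) ε := fun w hw => by
      rw [← ball_prod_same, ← ball_prod_same]
      exact ⟨hd', hτ', hw⟩
    -- `s₁` and `s₂` record the signs at the reference point `(d, τ, p)`, which persist in its
    -- neighbourhood.
    refine ⟨(hball _ (hmem p (mem_ball_self hε))).1, fun l hl =>
      ⟨((d / 2 + τ) * b l p).re, ((d / 2 - τ) * b l p).re, (H l hl).2.2, fun w hw => ?_⟩⟩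
    exact (hball _ (hmem w hw)).2 l hl

namespace IsPiecewisePrimitive

variable {r : ℕ} {p : ℂ} {ρ₀ : ℝ} {A F : Fin r → ℂ → ℂ} {M : Fin r → Set ℂ} {u : ℂ → ℝ}

/-- By the mean value theorem the increment is that of the gradient at a point of the segment. The
factor `σ` only carries a sign, so that increase and decrease are treated together. -/
theorem mul_re_sub_pos (h : IsPiecewisePrimitive p ρ₀ A F M u) (i l : Fin r) {δ σ c : ℝ} {d a b : ℂ}
    (hδ : δ ≤ ρ₀) (hd : ∀ w ∈ ball p δ, 0 < σ * (d * (A l w - A i w)).re) (ha : a ∈ ball p δ)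
    (hb : b ∈ ball p δ) (hc : 0 < c) (hab : b - a = c * d) :
    0 < σ * (((F l b).re - (F i b).re) - ((F l a).re - (F i a).re)) := by
  obtain ⟨w, hw, he⟩ := h.exists_re_sub_eq i l (ball_subset_ball hδ ha) (ball_subset_ball hδ hb)
  have := hd w ((convex_ball p δ).segment_subset ha hb hw)
  rw [he, hab, mul_assoc (c : ℂ), Complex.re_ofReal_mul]
  have h2 := mul_pos hc this
  nlinarith

theorem strictAntiOn_path (h : IsPiecewisePrimitive p ρ₀ A F M u) (i l : Fin r) {δ σ n T : ℝ}
    {d : ℂ} {γ : ℝ → ℂ} (hδ : δ ≤ ρ₀) (hn : 0 < n)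
    (hd : ∀ w ∈ ball p δ, 0 < σ * (d * (A l w - A i w)).re)
    (hγ : ∀ t ∈ Icc T (T + 1), γ t ∈ ball p δ)
    (hγd : ∀ s ∈ Icc T (T + 1), ∀ t ∈ Icc T (T + 1), γ t - γ s = ((t - s) * n : ℝ) * d)
    (hσ : σ < 0) : StrictAntiOn (fun t => (F l (γ t)).re - (F i (γ t)).re) (Icc T (T + 1)) := by
  intro s hs t ht hst
  have := h.mul_re_sub_pos i l hδ hd (hγ s hs) (hγ t ht) (mul_pos (sub_pos.2 hst) hn) (hγd s hs t ht)
  simp only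
  nlinarith

theorem strictMonoOn_path (h : IsPiecewisePrimitive p ρ₀ A F M u) (i l : Fin r) {δ σ n T : ℝ}
    {d : ℂ} {γ : ℝ → ℂ} (hδ : δ ≤ ρ₀) (hn : 0 < n)
    (hd : ∀ w ∈ ball p δ, 0 < σ * (d * (A l w - A i w)).re)
    (hγ : ∀ t ∈ Icc T (T + 1), γ t ∈ ball p δ)
    (hγd : ∀ s ∈ Icc T (T + 1), ∀ t ∈ Icc T (T + 1), γ t - γ s = ((t - s) * n : ℝ) * d)
    (hσ : 0 < σ) : StrictMonoOn (fun t => (F l (γ t)).re - (F i (γ t)).re) (Icc T (T + 1)) := by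
  intro s hs t ht hst
  have := h.mul_re_sub_pos i l hδ hd (hγ s hs) (hγ t ht) (mul_pos (sub_pos.2 hst) hn) (hγd s hs t ht)
  have := pos_of_mul_pos_right this hσ.le
  simp only
  linarith

/-- Along a suitable polygonal path which avoids an exceptional point, the local description as a
maximum propagates. -/
theorem le_of_isMaxAt_of_path (h : IsPiecewisePrimitive p ρ₀ A F M u) {i : Fin r} {δ n : ℝ}
    {q x y d₁ d₂ : ℂ} (hδ : δ ≤ ρ₀) (hn : 0 < n) (h1 : x - q = n * d₁) (h2 : y - x = n * d₂)
    (hd : ∀ l, l ≠ i → ∃ s₁ s₂ : ℝ, (s₁ < 0 ∨ 0 < s₂) ∧ ∀ w ∈ ball p δ,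
        0 < s₁ * (d₁ * (A l w - A i w)).re ∧ 0 < s₂ * (d₂ * (A l w - A i w)).re)
    (hq : q ∈ M i) (hqp : q ∈ ball p δ) (hxp : x ∈ ball p δ) (hyp : y ∈ ball p δ)
    (hqx : ∀ w ∈ segment ℝ q x, IsMaxAt F u w) (hxy : ∀ w ∈ segment ℝ x y, IsMaxAt F u w) :
    u q - (F i q).re ≤ u y - (F i y).re := by
  -- The polygon `q`, `x`, `y`, traversed on `[0, 1]` and `[1, 2]`, in one formula so that
  -- continuity is immediate.
  set γ : ℝ → ℂ := fun t => q + (min t 1 : ℝ) • (x - q) + (max (t - 1) 0 : ℝ) • (y - x) with hγ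
  have hγc : Continuous γ := by fun_prop
  have hγ1 : ∀ t : ℝ, t ≤ 1 → γ t = q + t • (x - q) := fun t ht => by
    simp only [hγ, min_eq_left ht, max_eq_right (sub_nonpos.2 ht), zero_smul, add_zero]
  have hγ2 : ∀ t : ℝ, 1 ≤ t → γ t = x + (t - 1) • (y - x) := fun t ht => by
    simp only [hγ, min_eq_right ht, max_eq_left (sub_nonneg.2 ht), one_smul, add_sub_cancel]
  have hm1 : ∀ t ∈ Icc (0 : ℝ) 1, γ t ∈ segment ℝ q x := fun t ht => by
    rw [hγ1 t ht.2, segment_eq_image']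
    exact ⟨t, ht, rfl⟩
  have hm2 : ∀ t ∈ Icc (1 : ℝ) 2, γ t ∈ segment ℝ x y := fun t ht => by
    rw [hγ2 t ht.1, segment_eq_image']
    exact ⟨t - 1, ⟨by linarith [ht.1], by linarith [ht.2]⟩, rfl⟩
  have hin1 : ∀ t ∈ Icc (0 : ℝ) 1, γ t ∈ ball p δ := fun t ht =>
    (convex_ball p δ).segment_subset hqp hxp (hm1 t ht)
  have hin2 : ∀ t ∈ Icc (1 : ℝ) 2, γ t ∈ ball p δ := fun t ht =>
    (convex_ball p δ).segment_subset hxp hyp (hm2 t ht)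
  have hin : ∀ t ∈ Icc (0 : ℝ) 2, γ t ∈ ball p ρ₀ := fun t ht => ball_subset_ball hδ <| by
    rcases le_total t 1 with h | h
    · exact hin1 t ⟨ht.1, h⟩
    · exact hin2 t ⟨h, ht.2⟩
  have hmax : ∀ t ∈ Icc (0 : ℝ) 2, IsMaxAt F u (γ t) := fun t ht => by
    rcases le_total t 1 with h | h
    · exact hqx _ (hm1 t ⟨ht.1, h⟩)
    · exact hxy _ (hm2 t ⟨h, ht.2⟩)
  have hF : ∀ l, ContinuousOn (fun t => (F l (γ t)).re) (Icc 0 2) := fun l =>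
    (h.continuousOn_re l).comp hγc.continuousOn hin
  have hγd1 : ∀ s ∈ Icc (0 : ℝ) 1, ∀ t ∈ Icc (0 : ℝ) 1, γ t - γ s = ((t - s) * n : ℝ) * d₁ := by
    intro s hs t ht
    rw [hγ1 s hs.2, hγ1 t ht.2, h1, Complex.real_smul, Complex.real_smul]
    push_cast
    ring
  have hγd2 : ∀ s ∈ Icc (1 : ℝ) 2, ∀ t ∈ Icc (1 : ℝ) 2, γ t - γ s = ((t - s) * n : ℝ) * d₂ := by
    intro s hs t ht
    rw [hγ2 s hs.1, hγ2 t ht.1, h2, Complex.real_smul, Complex.real_smul]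
    push_cast
    ring
  have hγ0 : γ 0 = q := by rw [hγ1 0 zero_le_one, zero_smul, add_zero]
  have hγ2' : γ 2 = y := by rw [hγ2 2 one_le_two]; norm_num
  have key := le_of_locally_isGreatest (f := fun t => u (γ t) - (F i (γ t)).re)
    (G := fun l t => (F l (γ t)).re - (F i (γ t)).re)
    ((h.continuous.comp hγc).continuousOn.sub (hF i)) (fun l => (hF l).sub (hF i)) ?_ ?_ ?_
  · simpa only [hγ0, hγ2'] using key
  · have h3 := h.eventually_sub_eq hq (ball_subset_ball hδ hqp)
    rw [← hγ0] at h3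
    obtain ⟨ε, hε, hball⟩ := Metric.eventually_nhds_iff.1 (hγc.continuousAt.eventually h3)
    refine ⟨ε / 2, by positivity, fun s hs => hball ?_⟩
    rw [Real.dist_eq, sub_zero, abs_of_nonneg hs.1]
    linarith [hs.2]
  · intro t ht
    obtain ⟨c, hc⟩ := hmax t ⟨ht.1.le, ht.2.le⟩
    refine ⟨c, ?_⟩
    filter_upwards [hγc.continuousAt.eventually hc] with s hs
    obtain ⟨⟨l, hl⟩, hub⟩ := hs
    refine ⟨⟨l, ?_⟩, ?_⟩
    · simp only at hl ⊢
      linarith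
    · rintro _ ⟨l', rfl⟩
      have := hub ⟨l', rfl⟩
      simp only at this ⊢
      linarith
  · intro l t ht
    rcases eq_or_ne l i with rfl | hl
    · refine Or.inr fun _ _ _ _ _ => by simp
    obtain ⟨s₁, s₂, hs, hw⟩ := hd l hl
    have e1 : (0 : ℝ) + 1 = 1 := by norm_num
    have e2 : (1 : ℝ) + 1 = 2 := by norm_num
    have anti1 := h.strictAntiOn_path i l (T := 0) (γ := γ) hδ hn (fun w hb => (hw w hb).1)
    have mono1 := h.strictMonoOn_path i l (T := 0) (γ := γ) hδ hn (fun w hb => (hw w hb).1)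
    have anti2 := h.strictAntiOn_path i l (T := 1) (γ := γ) hδ hn (fun w hb => (hw w hb).2)
    have mono2 := h.strictMonoOn_path i l (T := 1) (γ := γ) hδ hn (fun w hb => (hw w hb).2)
    rw [e1] at anti1 mono1
    rw [e2] at anti2 mono2
    specialize anti1 hin1 hγd1
    specialize mono1 hin1 hγd1
    specialize anti2 hin2 hγd2
    specialize mono2 hin2 hγd2
    have hs₁ : s₁ ≠ 0 := fun h0 => by simpa [h0] using (hw q hqp).1
    have hs₂ : s₂ ≠ 0 := fun h0 => by simpa [h0] using (hw q hqp).2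
    have hun : Icc (0 : ℝ) 1 ∪ Icc 1 2 = Icc 0 2 := Icc_union_Icc_eq_Icc zero_le_one one_le_two
    -- Possible sign patterns on the two pieces are (-,-), (-,+) and (+,+); the pattern (+,-) is
    -- excluded by the choice of bend.
    rcases lt_or_gt_of_ne hs₁ with hneg | hpos
    · rcases lt_or_gt_of_ne hs₂ with hneg2 | hpos2
      · have := (anti1 hneg).union (anti2 hneg2) (isGreatest_Icc zero_le_one) (isLeast_Icc one_le_two)
        rw [hun] at this
        exact Or.inl fun s hs =>
          this ⟨hs.1, hs.2.le.trans ht.2.le⟩ ⟨ht.1.le, ht.2.le⟩ hs.2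
      · rcases le_total t 1 with ht1 | ht1
        · exact Or.inl fun s hs =>
            anti1 hneg ⟨hs.1, hs.2.le.trans ht1⟩ ⟨ht.1.le, ht1⟩ hs.2
        · exact Or.inr ((mono2 hpos2).monotoneOn.mono (Icc_subset_Icc_left ht1))
    · have hpos2 : 0 < s₂ := hs.resolve_left hpos.not_gt
      have := (mono1 hpos).union (mono2 hpos2) (isGreatest_Icc zero_le_one) (isLeast_Icc one_le_two)
      rw [hun] at this
      exact Or.inr (this.monotoneOn.mono (Icc_subset_Icc_left ht.1.le))

end IsPiecewisePrimitive

/-! ### Removing an isolated exceptional point. -/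

/-- Bad corners `x` lie on the line through `q` and `z` or the line through `y` and `z`. Both are
null, while a ball has positive measure. -/
theorem exists_mem_ball_forall_notMem_segment {q y z c : ℂ} {ε : ℝ} (hε : 0 < ε) (hq : q ≠ z)
    (hy : y ≠ z) : ∃ x ∈ ball c ε, z ∉ segment ℝ q x ∧ z ∉ segment ℝ x y := by
  have hline : ∀ a b : ℂ, volume (line[ℝ, a, b] : Set ℂ) = 0 := by
    intro a b
    refine Measure.addHaar_affineSubspace volume _ fun htop => ?_
    have h1 := (collinear_pair ℝ a b)
    have h2 : Module.finrank ℝ (vectorSpan ℝ ({a, b} : Set ℂ)) ≤ 1 := h1.finrank_le_one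
    rw [← direction_affineSpan, htop, AffineSubspace.direction_top, finrank_top,
      Complex.finrank_real_complex] at h2
    omega
  have hpos : 0 < volume (ball c ε) := measure_ball_pos volume c hε
  obtain ⟨x, hx, hxn⟩ : ∃ x ∈ ball c ε, x ∉ (line[ℝ, q, z] : Set ℂ) ∪ line[ℝ, y, z] := by
    by_contra! hcon
    exact hpos.ne' (measure_mono_null hcon (measure_union_null (hline q z) (hline y z)))
  have aux : ∀ a : ℂ, a ≠ z → x ∉ (line[ℝ, a, z] : Set ℂ) → z ∉ segment ℝ a x := by
    intro a ha hxa hz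
    rw [segment_eq_image_lineMap] at hz
    obtain ⟨t, -, ht⟩ := hz
    have ht0 : t ≠ 0 := by
      rintro rfl
      exact ha (by simpa using ht)
    apply hxa
    have h3 : AffineMap.lineMap a z t⁻¹ = x := by
      rw [← ht, AffineMap.lineMap_apply, AffineMap.lineMap_apply]
      simp [ht0]
    exact h3 ▸ AffineMap.lineMap_mem_affineSpan_pair _ _ _
  refine ⟨x, hx, aux q hq fun h => hxn (Or.inl h), ?_⟩
  rw [segment_symm]
  exact aux y hy fun h => hxn (Or.inr h)

namespace IsPiecewisePrimitive

variable {r : ℕ} {p : ℂ} {ρ₀ : ℝ} {A F : Fin r → ℂ → ℂ} {M : Fin r → Set ℂ} {u : ℂ → ℝ}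

/-- If `u` is locally a maximum near each point of a punctured disc, every gradient supports `u`. -/
theorem exists_supportsOn_of_punctured (h : IsPiecewisePrimitive p ρ₀ A F M u)
    (h2 : ∀ i j k, i ≠ j → j ≠ k → i ≠ k → ∀ t : ℝ, A i p - A k p ≠ t * (A j p - A k p))
    (h3 : ∀ i k, i ≠ k → A i p ≠ A k p) (i : Fin r) :
    ∃ δ > 0, ∀ z ρ, 0 < ρ → ball z ρ ⊆ ball p δ →
      (∀ w ∈ ball z ρ, w ≠ z → IsMaxAt F u w) → SupportsOn (F i) (M i) u (ball z (ρ / 4)) := by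
  obtain ⟨δ', hδ', hbend⟩ := exists_uniform_bend (b := fun l w => A l w - A i w) (i := i) (p := p)
    (fun l => (h.continuousAt_coeff l).sub (h.continuousAt_coeff i))
    (fun l hl => sub_ne_zero.2 (h3 l i hl)) (fun l j hl hj hlj t => h2 l j i hlj hj hl t)
  refine ⟨min δ' ρ₀, lt_min hδ' h.pos, fun z ρ hρ hzδ hmax => ?_⟩
  have hδ₀ : min δ' ρ₀ ≤ ρ₀ := min_le_right _ _
  set δ := min δ' ρ₀ with hδ
  have hlt : ∀ w ∈ ball z (ρ / 4), w ∈ ball z ρ := fun w hw =>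
    ball_subset_ball (by linarith) hw
  have generic : ∀ q ∈ M i, q ∈ ball z (ρ / 4) → q ≠ z → ∀ y ∈ ball z (ρ / 4), y ≠ z → y ≠ q →
      u q - (F i q).re ≤ u y - (F i y).re := by
    intro q hq hqz hqne y hyz hyne hyq
    set n : ℝ := ‖y - q‖ with hn
    have hn0 : 0 < n := norm_pos_iff.2 (sub_ne_zero.2 hyq)
    have hnC : (n : ℂ) ≠ 0 := by exact_mod_cast hn0.ne'
    have hnρ : n < ρ / 2 := by
      rw [mem_ball] at hqz hyz
      rw [hn, ← dist_eq_norm]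
      linarith [dist_triangle_right y q z]
    have hd1 : (y - q) / n ∈ sphere (0 : ℂ) 1 := by
      rw [mem_sphere_zero_iff_norm, norm_div, Complex.norm_real, Real.norm_of_nonneg hn0.le]
      exact div_self hn0.ne'
    obtain ⟨τ, ε, hε, hτ⟩ := hbend _ hd1
    -- The corner is the midpoint displaced by `n * τ'`. The bend allows a whole ball of `τ'`, which
    -- leaves the freedom to avoid `z`; since `‖τ'‖ < 1` and `n < ρ / 2`, the corner stays in the
    -- disc of radius `ρ`.
    obtain ⟨x, hx, hzq, hzy⟩ := exists_mem_ball_forall_notMem_segment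
      (c := (q + y) / 2 + n * τ) (ε := n * ε) (mul_pos hn0 hε) hqne hyne
    obtain ⟨τ', rfl⟩ : ∃ τ' : ℂ, x = (q + y) / 2 + n * τ' :=
      ⟨(x - (q + y) / 2) / n, by rw [mul_div_cancel₀ _ hnC, add_sub_cancel]⟩
    have hτ' : τ' ∈ ball τ ε := by
      rw [mem_ball_iff_norm, add_sub_add_left_eq_sub, ← mul_sub, norm_mul, Complex.norm_real,
        Real.norm_of_nonneg hn0.le] at hx
      exact mem_ball_iff_norm.2 (lt_of_mul_lt_mul_left hx hn0.le)
    obtain ⟨hτn, hdir⟩ := hτ τ' hτ'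
    have hxz : (q + y) / 2 + n * τ' ∈ ball z ρ := by
      rw [mem_ball_iff_norm] at hqz hyz ⊢
      have e1 : (q + y) / 2 + n * τ' - z = (q - z) / 2 + (y - z) / 2 + n * τ' := by ring
      rw [e1]
      refine (norm_add₃_le).trans_lt ?_
      rw [norm_div, norm_div, norm_mul, Complex.norm_real, Real.norm_of_nonneg hn0.le]
      norm_num
      nlinarith [mul_lt_of_lt_one_right hn0 hτn]
    have hseg1 := (convex_ball z ρ).segment_subset (hlt q hqz) hxz
    have hseg2 := (convex_ball z ρ).segment_subset hxz (hlt y hyz)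
    refine h.le_of_isMaxAt_of_path (δ := δ) (n := n) (d₁ := (y - q) / n / 2 + τ')
      (d₂ := (y - q) / n / 2 - τ') hδ₀ hn0 ?_ ?_ ?_ hq (hzδ (hlt q hqz)) (hzδ hxz) (hzδ (hlt y hyz))
      (fun w hw => hmax w (hseg1 hw) ?_) (fun w hw => hmax w (hseg2 hw) ?_)
    · field_simp
      ring
    · field_simp
      ring
    · intro l hl
      obtain ⟨s₁, s₂, hs, hw⟩ := hdir l hl
      exact ⟨s₁, s₂, hs, fun w hwb => hw w (ball_subset_ball (min_le_left _ _) hwb)⟩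
    · rintro rfl
      exact hzq hw
    · rintro rfl
      exact hzy hw
  have hvc : ContinuousOn (fun w => u w - (F i w).re) (ball p ρ₀) :=
    h.continuous.continuousOn.sub (h.continuousOn_re i)
  have hρ4 : 0 < ρ / 4 := by positivity
  have step : ∀ q ∈ M i, q ∈ ball z (ρ / 4) → q ≠ z → ∀ y ∈ ball z (ρ / 4),
      u q - (F i q).re ≤ u y - (F i y).re := by
    intro q hq hqz hqne y hyz
    rcases eq_or_ne y q with rfl | hyq
    · exact le_rfl
    rcases eq_or_ne y z with rfl | hyne
    · have hy0 : y ∈ ball p ρ₀ := ball_subset_ball hδ₀ (hzδ (mem_ball_self hρ))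
      have ht := ((hvc.continuousAt (isOpen_ball.mem_nhds hy0)).tendsto).mono_left
        (nhdsWithin_le_nhds (s := {y}ᶜ))
      refine ge_of_tendsto ht ?_
      filter_upwards [self_mem_nhdsWithin, nhdsWithin_le_nhds (isOpen_ball.mem_nhds hyz),
        nhdsWithin_le_nhds (isOpen_ne.mem_nhds hyq)] with w h1 h2 h3
      exact generic q hq hqz hqne w h2 h1 h3
    · exact generic q hq hqz hqne y hyz hyne hyq
  intro q hq hqz y hyz
  rcases eq_or_ne q z with rfl | hqne
  · have hq0 : q ∈ ball p ρ₀ := ball_subset_ball hδ₀ (hzδ (mem_ball_self hρ))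
    -- If `q` is the centre itself, it is replaced by a nearby point of `M i` at which `u` - Re `F
    -- i` has the same value.
    have hev : ∀ᶠ w in 𝓝[≠] q, u w - (F i w).re = u q - (F i q).re ∧ w ∈ M i ∧ w ∈ ball q (ρ / 4) :=
      ((h.eventually_sub_eq hq hq0).and (((h.isOpen i).eventually_mem hq).and
        (isOpen_ball.eventually_mem hqz))).filter_mono nhdsWithin_le_nhds
    obtain ⟨w, ⟨h1, h2, h3⟩, hne⟩ := (hev.and self_mem_nhdsWithin).exists
    rw [← h1]
    exact step w h2 h3 hne y hyz
  · exact step q hq hqz hqne y hyz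

/-- Two differences of the harmonic functions with independent gradients separate points. -/
theorem exists_eq_of_sub_eq (h : IsPiecewisePrimitive p ρ₀ A F M u) {i j k : Fin r}
    (hki : A k p ≠ A i p) (hind : ∀ t : ℝ, A j p - A i p ≠ t * (A k p - A i p)) :
    ∃ δ > 0, ∀ z ∈ ball p δ, ∀ z' ∈ ball p δ,
      (F j z').re - (F i z').re = (F j z).re - (F i z).re →
      (F k z').re - (F i z').re = (F k z).re - (F i z).re → z' = z := by
  have hp : (starRingEnd ℂ (A k p - A i p) * (A j p - A i p)).im ≠ 0 := by
    intro him
    set β := A k p - A i p with hβ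
    have hβ0 : β ≠ 0 := sub_ne_zero.2 hki
    have hn : (Complex.normSq β : ℂ) ≠ 0 := by exact_mod_cast (Complex.normSq_pos.2 hβ0).ne'
    refine hind ((starRingEnd ℂ β * (A j p - A i p)).re / Complex.normSq β) ?_
    have e1 : (((starRingEnd ℂ β * (A j p - A i p)).re : ℝ) : ℂ) =
        starRingEnd ℂ β * (A j p - A i p) := Complex.ext (by simp) (by simpa using him.symm)
    rw [Complex.ofReal_div, e1, div_mul_eq_mul_div, eq_div_iff hn, Complex.normSq_eq_conj_mul_self]
    ring
  -- The determinant of the two gradients is taken at two independent points, because the mean value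
  -- theorem gives a different intermediate point for each difference.
  have hc : ContinuousAt (fun x : ℂ × ℂ =>
      (starRingEnd ℂ (A k x.1 - A i x.1) * (A j x.2 - A i x.2)).im) (p, p) := by
    have c1 : ∀ l, ContinuousAt (fun x : ℂ × ℂ => A l x.1) (p, p) := fun l =>
      ContinuousAt.comp (f := Prod.fst) (x := (p, p)) (h.continuousAt_coeff l) continuousAt_fst
    have c2 : ∀ l, ContinuousAt (fun x : ℂ × ℂ => A l x.2) (p, p) := fun l =>
      ContinuousAt.comp (f := Prod.snd) (x := (p, p)) (h.continuousAt_coeff l) continuousAt_snd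
    exact Complex.continuous_im.continuousAt.comp
      ((Complex.continuous_conj.continuousAt.comp ((c1 k).sub (c1 i))).mul ((c2 j).sub (c2 i)))
  obtain ⟨ε, hε, hball⟩ := Metric.eventually_nhds_iff_ball.1 (hc.eventually_ne hp)
  refine ⟨min ε ρ₀, lt_min hε h.pos, fun z hz z' hz' hj hk => ?_⟩
  have hsub0 : ball p (min ε ρ₀) ⊆ ball p ρ₀ := ball_subset_ball (min_le_right _ _)
  have hsubε : ball p (min ε ρ₀) ⊆ ball p ε := ball_subset_ball (min_le_left _ _)
  obtain ⟨w, hw, ew⟩ := h.exists_re_sub_eq i k (hsub0 hz) (hsub0 hz')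
  obtain ⟨w', hw', ew'⟩ := h.exists_re_sub_eq i j (hsub0 hz) (hsub0 hz')
  rw [hk, sub_self] at ew
  rw [hj, sub_self] at ew'
  have hww := hball (w, w') (by
    rw [← ball_prod_same]
    exact ⟨hsubε ((convex_ball p _).segment_subset hz hz' hw),
      hsubε ((convex_ball p _).segment_subset hz hz' hw')⟩)
  by_contra hne
  have he : Complex.normSq (z' - z) ≠ 0 := (Complex.normSq_pos.2 (sub_ne_zero.2 hne)).ne'
  apply mul_ne_zero he hww
  have e1 : ((z' - z) * (A k w - A i w)).re = 0 := by linarith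
  have e2 : ((z' - z) * (A j w' - A i w')).re = 0 := by linarith
  have e3 : (starRingEnd ℂ ((z' - z) * (A k w - A i w)) * ((z' - z) * (A j w' - A i w'))).im = 0 := by
    rw [Complex.mul_im, Complex.conj_re, Complex.conj_im, e1, e2]
    ring
  rw [← e3, ← Complex.im_ofReal_mul, Complex.normSq_eq_conj_mul_self, map_mul]
  congr 1
  ring

/-- The support inequality passes to limits of points of `M k`; applied in both directions it gives
equality. -/
theorem sub_eq_of_mem_closure (h : IsPiecewisePrimitive p ρ₀ A F M u) {k : Fin r} {s : Set ℂ}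
    (hs : IsOpen s) (hsp : s ⊆ ball p ρ₀) (hsup : SupportsOn (F k) (M k) u s) {z z' : ℂ}
    (hz : z ∈ s) (hzM : z ∈ closure (M k)) (hz' : z' ∈ s) (hzM' : z' ∈ closure (M k)) :
    u z - (F k z).re = u z' - (F k z').re := by
  have aux : ∀ a ∈ s, a ∈ closure (M k) → ∀ b ∈ s, u a - (F k a).re ≤ u b - (F k b).re := by
    intro a ha haM b hb
    have hc := (h.continuous.continuousAt (x := a)).sub
      ((h.continuousOn_re k).continuousAt (isOpen_ball.mem_nhds (hsp ha)))
    refine le_of_tendsto_of_frequently hc.tendsto ?_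
    refine ((mem_closure_iff_frequently.1 haM).and_eventually (hs.mem_nhds ha)).mono ?_
    rintro w ⟨h1, h2⟩
    exact hsup w h1 h2 b hb
  exact le_antisymm (aux z hz hzM z' hz') (aux z' hz' hzM' z hz)

theorem isMaxAt_of_forall_exists_supportsOn (h : IsPiecewisePrimitive p ρ₀ A F M u) {z : ℂ}
    (hz : z ∈ ball p ρ₀) (hs : ∀ i, ∃ ρ > 0, SupportsOn (F i) (M i) u (ball z ρ)) :
    IsMaxAt F u z := by
  have hev : ∀ᶠ ρ : ℝ in 𝓝[>] 0, ∀ i, SupportsOn (F i) (M i) u (ball z ρ) := by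
    rw [eventually_all]
    intro i
    obtain ⟨ρ, hρ, hi⟩ := hs i
    filter_upwards [Ioo_mem_nhdsGT hρ] with ρ' hρ' using hi.mono (ball_subset_ball hρ'.2.le)
  obtain ⟨ρ, hρ, hpos⟩ := (hev.and self_mem_nhdsWithin).exists
  exact h.isMaxAt_of_supportsOn hz hpos hρ

/-! ### Induction on the set of gradients present. -/

/-- The claim concerns all `z` near `p`, not only `p`, because the inductive step needs it on a
punctured neighbourhood of `z`. The gradients are compared at `p` alone, so exposedness need not be
re-examined as `z` moves. -/
theorem eventually_isMaxAt (h : IsPiecewisePrimitive p ρ₀ A F M u)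
    (h2 : ∀ i j k, i ≠ j → j ≠ k → i ≠ k → ∀ t : ℝ, A i p - A k p ≠ t * (A j p - A k p))
    (h3 : ∀ i k, i ≠ k → A i p ≠ A k p) (S : Finset (Fin r)) :
    ∀ᶠ z in 𝓝 p, (∀ j ∉ S, z ∉ closure (M j)) → IsMaxAt F u z := by
  classical
  induction S using Finset.strongInduction with
  | H S ih =>
  rcases forall_isExposedIn_or_exists_three (a := fun i => A i p) h2 h3 S with hall |
    ⟨k₁, m1, k₂, m2, k₃, m3, n12, n13, n23, x1, x2, x3⟩
  · have hev : ∀ᶠ z in 𝓝 p, ∀ k, k ∈ S → (∀ j ∉ S, z ∉ closure (M j)) →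
        ∃ ρ > 0, SupportsOn (F k) (M k) u (ball z ρ) := by
      rw [eventually_all]
      intro k
      by_cases hk : k ∈ S
      · exact (h.eventually_supportsOn_of_exposed (hall k hk)).mono fun z hz _ => hz
      · exact Eventually.of_forall fun _ hk' => absurd hk' hk
    filter_upwards [hev, ball_mem_nhds p h.pos] with z hz hzp hS
    refine h.isMaxAt_of_forall_exists_supportsOn hzp fun i => ?_
    by_cases hi : i ∈ S
    · exact hz i hi hS
    · obtain ⟨ρ, hρ, -, hd⟩ := exists_ball_disjoint (V := univ) univ_mem hS
      exact ⟨ρ, hρ, fun q hq hqz => absurd hqz (hd i hi q hq)⟩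
  · choose δ hδ hpunct using h.exists_supportsOn_of_punctured h2 h3
    obtain ⟨δ', hδ', hinj⟩ := h.exists_eq_of_sub_eq (i := k₁) (j := k₂) (k := k₃) (h3 _ _ n13.symm)
      (h2 k₂ k₃ k₁ n23 n13.symm n12.symm)
    -- The induction hypothesis is needed at the points `w` near `z` as well as at `z`.
    have ih' := fun k (hk : k ∈ S) => eventually_eventually_nhds.2 (ih _ (Finset.erase_ssubset hk))
    have hballs : ∀ᶠ z in 𝓝 p, ∀ i, z ∈ ball p (δ i) :=
      eventually_all.2 fun i => ball_mem_nhds p (hδ i)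
    filter_upwards [ih' k₁ m1, ih' k₂ m2, ih' k₃ m3, eventually_eventually_nhds.2 hballs,
      ball_mem_nhds p hδ', ball_mem_nhds p h.pos, h.eventually_supportsOn_of_exposed x1,
      h.eventually_supportsOn_of_exposed x2, h.eventually_supportsOn_of_exposed x3]
      with z i1 i2 i3 hzδ hzδ' hzp s1 s2 s3 hS
    have herase : ∀ w, (∀ j ∉ S, w ∉ closure (M j)) → ∀ k, w ∉ closure (M k) →
        ∀ j ∉ S.erase k, w ∉ closure (M j) := by
      intro w hw k hk j hj
      rcases eq_or_ne j k with rfl | hjk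
      · exact hk
      · exact hw j fun hjS => hj (Finset.mem_erase.2 ⟨hjk, hjS⟩)
    by_cases c1 : z ∈ closure (M k₁)
    swap
    · exact i1.self_of_nhds (herase z hS k₁ c1)
    by_cases c2 : z ∈ closure (M k₂)
    swap
    · exact i2.self_of_nhds (herase z hS k₂ c2)
    by_cases c3 : z ∈ closure (M k₃)
    swap
    · exact i3.self_of_nhds (herase z hS k₃ c3)
    obtain ⟨ρ₁, hρ₁, s1⟩ := s1 hS
    obtain ⟨ρ₂, hρ₂, s2⟩ := s2 hS
    obtain ⟨ρ₃, hρ₃, s3⟩ := s3 hS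
    have hSev : ∀ᶠ w in 𝓝 z, ∀ j, j ∉ S → w ∉ closure (M j) := by
      rw [eventually_all]
      intro j
      by_cases hj : j ∈ S
      · exact Eventually.of_forall fun _ h => absurd hj h
      · filter_upwards [isClosed_closure.isOpen_compl.mem_nhds (hS j hj)] with w hw _ using hw
    have hnear : ∀ᶠ w in 𝓝 z, (w ≠ z → IsMaxAt F u w) ∧ ∀ i, w ∈ ball p (δ i) := by
      set V : Set ℂ := ball z ρ₁ ∩ ball z ρ₂ ∩ ball z ρ₃ ∩ ball p ρ₀ with hV
      have hVo : IsOpen V := ((isOpen_ball.inter isOpen_ball).inter isOpen_ball).inter isOpen_ball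
      have hzV : z ∈ V :=
        ⟨⟨⟨mem_ball_self hρ₁, mem_ball_self hρ₂⟩, mem_ball_self hρ₃⟩, hzp⟩
      have hVp : V ⊆ ball p ρ₀ := fun w hw => hw.2
      filter_upwards [i1, i2, i3, hzδ, hSev, isOpen_ball.mem_nhds hzδ', hVo.mem_nhds hzV]
        with w j1 j2 j3 hwδ hwS hwδ' hwV
      refine ⟨fun hne => ?_, hwδ⟩
      by_contra hnot
      have d1 : w ∈ closure (M k₁) := by
        by_contra hc; exact hnot (j1 (herase w hwS k₁ hc))
      have d2 : w ∈ closure (M k₂) := by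
        by_contra hc; exact hnot (j2 (herase w hwS k₂ hc))
      have d3 : w ∈ closure (M k₃) := by
        by_contra hc; exact hnot (j3 (herase w hwS k₃ hc))
      -- Three constants are shared by `z` and `w`; subtracting eliminates `u` and leaves two
      -- equations that force `w = z`.
      have e1 := h.sub_eq_of_mem_closure hVo hVp (s1.mono fun w hw => hw.1.1.1) hzV c1 hwV d1
      have e2 := h.sub_eq_of_mem_closure hVo hVp (s2.mono fun w hw => hw.1.1.2) hzV c2 hwV d2
      have e3 := h.sub_eq_of_mem_closure hVo hVp (s3.mono fun w hw => hw.1.2) hzV c3 hwV d3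
      exact hne (hinj z hzδ' w hwδ' (by linarith) (by linarith))
    obtain ⟨ρ, hρ, hball⟩ := Metric.eventually_nhds_iff_ball.1 hnear
    exact h.isMaxAt_of_supportsOn hzp (ρ := ρ / 4) (by positivity) fun i =>
      hpunct i z ρ hρ (fun w hw => (hball w hw).2 i) fun w hw => (hball w hw).1

theorem isMaxAt_center (h : IsPiecewisePrimitive p ρ₀ A F M u)
    (h2 : ∀ i j k, i ≠ j → j ≠ k → i ≠ k → ∀ t : ℝ, A i p - A k p ≠ t * (A j p - A k p))
    (h3 : ∀ i k, i ≠ k → A i p ≠ A k p) : IsMaxAt F u p :=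
  (h.eventually_isMaxAt h2 h3 Finset.univ).self_of_nhds fun j hj => absurd (Finset.mem_univ j) hj

end IsPiecewisePrimitive

/-! ### Mollification and the distributional derivative. -/

/-- The identity `∂f/∂z = Φ` tested against smooth functions with compact support in `V`. -/
def TestsDz (f : ℂ → ℝ) (Φ : ℂ → ℂ) (V : Set ℂ) : Prop :=
  ∀ φ : ℂ → ℂ, ContDiff ℝ ∞ φ → HasCompactSupport φ → tsupport φ ⊆ V →
    ∫ z, Φ z * φ z = -∫ z, (f z : ℂ) * dz φ z

/-- The mollification of `f` by a bump function. -/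
noncomputable def mollify (ρ : ContDiffBump (0 : ℂ)) (f : ℂ → ℝ) : ℂ → ℝ :=
  ρ.normed volume ⋆[ContinuousLinearMap.lsmul ℝ ℝ, volume] f

theorem tsupport_normed_comp_sub (ρ : ContDiffBump (0 : ℂ)) (x : ℂ) :
    tsupport (fun w => ρ.normed volume (x - w)) = closedBall x ρ.rOut := by
  have h : (fun w => ρ.normed volume (x - w)) = ρ.normed volume ∘ (Homeomorph.subLeft x) := rfl
  rw [h, tsupport_comp_eq_preimage, ρ.tsupport_normed_eq]
  ext w
  simp [dist_eq_norm, norm_sub_rev]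

theorem hasCompactSupport_normed_comp_sub (ρ : ContDiffBump (0 : ℂ)) (x : ℂ) :
    HasCompactSupport (fun w => ρ.normed volume (x - w)) := by
  rw [HasCompactSupport, tsupport_normed_comp_sub]
  exact isCompact_closedBall _ _

theorem contDiff_normed_comp_sub (ρ : ContDiffBump (0 : ℂ)) (x : ℂ) {n : ℕ∞} :
    ContDiff ℝ n (fun w => ρ.normed volume (x - w)) :=
  ρ.contDiff_normed.comp (contDiff_const.sub contDiff_id)

theorem integrable_normed_comp_sub_mul (ρ : ContDiffBump (0 : ℂ)) (x : ℂ) {g : ℂ → ℝ}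
    (hg : LocallyIntegrable g) : Integrable fun w => ρ.normed volume (x - w) * g w :=
  hg.integrable_smul_left_of_hasCompactSupport
    (contDiff_normed_comp_sub ρ x (n := 0)).continuous (hasCompactSupport_normed_comp_sub ρ x)

theorem integral_normed_comp_sub (ρ : ContDiffBump (0 : ℂ)) (x : ℂ) :
    ∫ w, ρ.normed volume (x - w) = 1 := by
  rw [integral_sub_left_eq_self (fun w => ρ.normed volume w)]
  exact ρ.integral_normed

theorem dz_normed_comp_sub (ρ : ContDiffBump (0 : ℂ)) (x w : ℂ) :
    dz (fun w => (ρ.normed volume (x - w) : ℂ)) w =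
      -(fderiv ℝ (ρ.normed volume) (x - w) 1
        - Complex.I * fderiv ℝ (ρ.normed volume) (x - w) Complex.I) / 2 := by
  have h1 : HasFDerivAt (ρ.normed volume) (fderiv ℝ (ρ.normed volume) (x - w)) (x - w) :=
    ((ρ.contDiff_normed (n := 1)).differentiable one_ne_zero).differentiableAt.hasFDerivAt
  have h2 := Complex.ofRealCLM.hasFDerivAt.comp w (h1.comp w ((hasFDerivAt_id w).const_sub x))
  have h3 : fderiv ℝ (fun w => (ρ.normed volume (x - w) : ℂ)) w = _ := h2.fderiv
  rw [dz, h3]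
  simp
  ring

/-- The derivative of a mollification, expressed by the distributional derivative. -/
theorem hasFDerivAt_mollify {f : ℂ → ℝ} {Φ : ℂ → ℂ} {V : Set ℂ} (hf : LocallyIntegrable f)
    (hΦ : LocallyIntegrable Φ) (h : TestsDz f Φ V) (ρ : ContDiffBump (0 : ℂ)) {x : ℂ}
    (hx : closedBall x ρ.rOut ⊆ V) :
    ∃ L : ℂ →L[ℝ] ℝ, HasFDerivAt (mollify ρ f) L x ∧
      ∀ d, L d = ∫ w, ρ.normed volume (x - w) * (2 * (d * Φ w)).re := by
  refine ⟨_, (ρ.hasCompactSupport_normed (μ := volume)).hasFDerivAt_convolution_left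
    (ContinuousLinearMap.lsmul ℝ ℝ) ρ.contDiff_normed hf x, fun d => ?_⟩
  set P := fderiv ℝ (ρ.normed volume) with hP
  have hPc : Continuous P := (ρ.contDiff_normed (n := 1)).continuous_fderiv one_ne_zero
  have hPs : HasCompactSupport P := (ρ.hasCompactSupport_normed (μ := volume)).fderiv ℝ
  have hex : ConvolutionExistsAt P f x ((ContinuousLinearMap.lsmul ℝ ℝ).precompL ℂ) volume :=
    hPs.convolutionExists_left _ hPc hf x
  have e1 : (P ⋆[(ContinuousLinearMap.lsmul ℝ ℝ).precompL ℂ, volume] f) x d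
      = ∫ w, P (x - w) d * f w := by
    rw [convolution_def, ContinuousLinearMap.integral_apply hex]
    rw [← integral_sub_left_eq_self _ _ x]
    simp [ContinuousLinearMap.precompL_apply]
  rw [e1]
  -- The reflected bump serves as test function; the sign from differentiating `x - w` cancels the
  -- sign in the definition of the distributional derivative. For real `f` the derivative along `d`
  -- is 2 Re (`d` ∂f/∂z).
  set φ : ℂ → ℂ := fun w => (ρ.normed volume (x - w) : ℂ) with hφ
  have hφc : ContDiff ℝ ∞ φ := Complex.ofRealCLM.contDiff.comp (contDiff_normed_comp_sub ρ x)
  have hφs : HasCompactSupport φ :=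
    (hasCompactSupport_normed_comp_sub ρ x).comp_left (g := Complex.ofReal) Complex.ofReal_zero
  have hφt : tsupport φ ⊆ V := by
    refine (closure_mono ?_).trans ((tsupport_normed_comp_sub ρ x).subset.trans hx)
    intro w hw hw0
    exact hw (by simp [hφ, hw0])
  have hid := h φ hφc hφs hφt
  have hint1 : Integrable fun w => Φ w * φ w := by
    simpa [mul_comm] using hΦ.integrable_smul_left_of_hasCompactSupport hφc.continuous hφs
  have hint2 : ∀ v, Integrable fun w => P (x - w) v * f w := by
    intro v
    refine hf.integrable_smul_left_of_hasCompactSupport (g := fun w => P (x - w) v) (by fun_prop) ?_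
    have : HasCompactSupport ((fun y => P y v)) := hPs.comp_left (g := fun T : ℂ →L[ℝ] ℝ => T v) rfl
    exact this.comp_homeomorph (Homeomorph.subLeft x)
  have e2 : ∫ w, ρ.normed volume (x - w) * (2 * (d * Φ w)).re = (2 * d * ∫ w, Φ w * φ w).re := by
    rw [← integral_const_mul, ← Complex.reCLM_apply, ← Complex.reCLM.integral_comp_comm
      (hint1.const_mul _)]
    refine integral_congr_ae (Eventually.of_forall fun w => ?_)
    simp [hφ]
    ring
  have e3 : ∫ w, (f w : ℂ) * dz φ w
      = -(((∫ w, P (x - w) 1 * f w : ℝ) : ℂ) - Complex.I * (∫ w, P (x - w) Complex.I * f w : ℝ)) / 2 := by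
    rw [← integral_complex_ofReal, ← integral_complex_ofReal, ← integral_const_mul, ← integral_sub,
      ← integral_neg, ← integral_div]
    · refine integral_congr_ae (Eventually.of_forall fun w => ?_)
      simp only [hφ, dz_normed_comp_sub]
      push_cast
      ring
    · exact (hint2 1).ofReal
    · exact (hint2 Complex.I).ofReal.const_mul _
  have e4 : ∫ w, P (x - w) d * f w
      = d.re * (∫ w, P (x - w) 1 * f w) + d.im * ∫ w, P (x - w) Complex.I * f w := by
    rw [← integral_const_mul, ← integral_const_mul, ← integral_add ((hint2 1).const_mul _)
      ((hint2 Complex.I).const_mul _)]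
    refine integral_congr_ae (Eventually.of_forall fun w => ?_)
    have : P (x - w) d = d.re * P (x - w) 1 + d.im * P (x - w) Complex.I := by
      conv_lhs => rw [← Complex.re_add_im d]
      have e1 : (d.re : ℂ) = d.re • (1 : ℂ) := by simp
      have e2 : (d.im : ℂ) * Complex.I = d.im • Complex.I := by simp
      rw [e1, e2, map_add, map_smul, map_smul, smul_eq_mul, smul_eq_mul]
    simp only [this]
    ring
  rw [e2, hid, e3, e4]
  generalize (∫ w, P (x - w) 1 * f w) = a
  generalize (∫ w, P (x - w) Complex.I * f w) = b
  have : 2 * d * -(-((a : ℂ) - Complex.I * b) / 2) = d * (a - Complex.I * b) := by ring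
  rw [this]
  simp

/-- The integral is an average against a probability density supported in the closed ball of radius
`ρ.rOut`. -/
theorem le_integral_normed_mul {Φ : ℂ → ℂ} (hΦ : LocallyIntegrable Φ) (ρ : ContDiffBump (0 : ℂ))
    {x d : ℂ} {m : ℝ} (hm : ∀ᵐ w, w ∈ ball x ρ.rOut → m ≤ (2 * (d * Φ w)).re) :
    m ≤ ∫ w, ρ.normed volume (x - w) * (2 * (d * Φ w)).re := by
  have hg : LocallyIntegrable fun w => (2 * (d * Φ w)).re := by
    rw [locallyIntegrable_iff] at hΦ ⊢
    intro K hK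
    exact (((hΦ K hK).const_mul d).const_mul 2).re
  have e1 : m = ∫ w, ρ.normed volume (x - w) * m := by
    rw [integral_mul_const, integral_normed_comp_sub, one_mul]
  rw [e1]
  refine integral_mono_ae (integrable_normed_comp_sub_mul ρ x (locallyIntegrable_const m))
    (integrable_normed_comp_sub_mul ρ x hg) ?_
  filter_upwards [hm] with w hw
  by_cases hwx : w ∈ ball x ρ.rOut
  · exact mul_le_mul_of_nonneg_left (hw hwx) (ρ.nonneg_normed _)
  · have : ρ.normed volume (x - w) = 0 := by
      have : x - w ∉ Function.support (ρ.normed volume) := by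
        rw [ρ.support_normed_eq]
        simpa [dist_eq_norm, norm_sub_rev] using hwx
      simpa using this
    simp [this]

/-- A sequence of bump functions shrinking to the origin. -/
noncomputable def shrinkingBump (n : ℕ) : ContDiffBump (0 : ℂ) where
  rIn := 1 / (n + 1)
  rOut := 2 / (n + 1)
  rIn_pos := by positivity
  rIn_lt_rOut := by gcongr; norm_num

theorem tendsto_shrinkingBump_rOut : Tendsto (fun n => (shrinkingBump n).rOut) atTop (𝓝 0) := by
  have := (tendsto_one_div_add_atTop_nhds_zero_nat (𝕜 := ℝ)).const_mul 2
  simpa [shrinkingBump, div_eq_mul_inv] using this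

/-- A function with bounded distributional derivative has a continuous representative. -/
theorem exists_continuous_ae_eq {f : ℂ → ℝ} {Φ : ℂ → ℂ} {p : ℂ} {R C : ℝ} (hR : 0 < R)
    (hf : LocallyIntegrable f) (hΦ : LocallyIntegrable Φ) (h : TestsDz f Φ (ball p R))
    (hC : ∀ᵐ w, w ∈ ball p R → ‖Φ w‖ ≤ C) :
    ∃ u : ℂ → ℝ, Continuous u ∧ ∀ᵐ w, w ∈ ball p (R / 2) → f w = u w := by
  have hae : ∀ᵐ x, Tendsto (fun n => mollify (shrinkingBump n) f x) atTop (𝓝 (f x)) :=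
    ContDiffBump.ae_convolution_tendsto_right_of_locallyIntegrable (K := 2)
      tendsto_shrinkingBump_rOut (Eventually.of_forall fun n => by simp [shrinkingBump]; ring_nf; rfl) hf
  set T := {x | Tendsto (fun n => mollify (shrinkingBump n) f x) atTop (𝓝 (f x))} with hT
  have hbound : ∀ᶠ n in atTop, ∀ x ∈ ball p (R / 2), ∃ L : ℂ →L[ℝ] ℝ,
      HasFDerivAt (mollify (shrinkingBump n) f) L x ∧ ‖L‖ ≤ 2 * max C 0 := by
    filter_upwards [tendsto_shrinkingBump_rOut.eventually (gt_mem_nhds (half_pos hR))] with n hn x hx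
    have hball : closedBall x (shrinkingBump n).rOut ⊆ ball p R := by
      intro w hw
      rw [mem_ball] at hx ⊢
      rw [mem_closedBall] at hw
      linarith [dist_triangle w x p]
    obtain ⟨L, hL, hLd⟩ := hasFDerivAt_mollify hf hΦ h (shrinkingBump n) hball
    refine ⟨L, hL, L.opNorm_le_bound (by positivity) fun d => ?_⟩
    have hlow : ∀ d, -(2 * max C 0 * ‖d‖) ≤ L d := by
      intro d
      rw [hLd]
      apply le_integral_normed_mul hΦ
      filter_upwards [hC] with w hw hwx
      have h1 := hw (hball (ball_subset_closedBall hwx))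
      have h2 := neg_le_of_abs_le (Complex.abs_re_le_norm (2 * (d * Φ w)))
      rw [norm_mul, norm_mul, Complex.norm_ofNat] at h2
      have h3 : ‖d‖ * ‖Φ w‖ ≤ ‖d‖ * max C 0 := by gcongr; exact h1.trans (le_max_left _ _)
      linarith
    rw [Real.norm_eq_abs, abs_le]
    refine ⟨hlow d, ?_⟩
    have := hlow (-d)
    rw [map_neg, norm_neg] at this
    linarith
  -- On `T` the function `f` is a pointwise limit of mollifications with a common Lipschitz
  -- constant; `T` has full measure, so a Lipschitz extension is the required representative.
  have hlip : LipschitzOnWith (Real.toNNReal (2 * max C 0)) f (T ∩ ball p (R / 2)) := by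
    refine LipschitzOnWith.of_dist_le_mul fun x hx y hy => ?_
    have hlim := ((hx.1.sub hy.1).norm)
    rw [dist_eq_norm, dist_eq_norm, Real.coe_toNNReal _ (by positivity)]
    refine le_of_tendsto hlim ?_
    filter_upwards [hbound] with n hn
    choose! L hL hLn using hn
    exact (convex_ball p (R / 2)).norm_image_sub_le_of_norm_hasFDerivWithin_le
      (fun w hw => (hL w hw).hasFDerivWithinAt) hLn hy.2 hx.2
  obtain ⟨u, hu, heq⟩ := hlip.extend_real
  refine ⟨u, hu.continuous, ?_⟩
  filter_upwards [hae] with w hw hwp using heq ⟨hw, hwp⟩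

/-- A sign of the distributional derivative along a direction gives monotonicity. -/
theorem le_of_testsDz {u : ℂ → ℝ} {Φ A F : ℂ → ℂ} {V : Set ℂ} (hu : Continuous u)
    (hΦ : LocallyIntegrable Φ) (h : TestsDz u Φ V) (hA : ContinuousOn A V)
    (hF : ∀ w ∈ V, HasDerivAt F (2 * A w) w) {z d a : ℂ} {s : ℝ} (hzV : ball z s ⊆ V)
    (hd : ∀ᵐ w, w ∈ ball z s → 0 ≤ (d * (Φ w - A w)).re) (ha : a ∈ ball z s)
    (had : a + d ∈ ball z s) : u a - (F a).re ≤ u (a + d) - (F (a + d)).re := by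
  -- The gap between `s₁` and `s₂` makes room for the bump, and `s₂ < s` gives a compact disc on
  -- which `A` is uniformly continuous.
  obtain ⟨s₁, hs₁, hs₁s⟩ : ∃ s₁, max (dist a z) (dist (a + d) z) < s₁ ∧ s₁ < s :=
    exists_between (max_lt ha had)
  obtain ⟨s₂, hs₁₂, hs₂s⟩ := exists_between hs₁s
  have ha1 : a ∈ ball z s₁ := (le_max_left _ _).trans_lt hs₁
  have had1 : a + d ∈ ball z s₁ := (le_max_right _ _).trans_lt hs₁
  have hcV : closedBall z s₂ ⊆ V := (closedBall_subset_ball hs₂s).trans hzV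
  have hunif := (isCompact_closedBall z s₂).uniformContinuousOn_of_continuous (hA.mono hcV)
  -- The averaged derivative sees `A w` near `x` instead of `A x`; this costs `2 * ‖d‖ * ε`, which
  -- vanishes in the limit.
  have key : ∀ ε > 0, u a - (F a).re - 2 * ‖d‖ * ε ≤ u (a + d) - (F (a + d)).re := by
    intro ε hε
    obtain ⟨η, hη, hAη⟩ := Metric.uniformContinuousOn_iff.1 hunif ε hε
    have lim : ∀ x, Tendsto (fun n => mollify (shrinkingBump n) u x) atTop (𝓝 (u x)) :=
      ContDiffBump.convolution_tendsto_right_of_continuous tendsto_shrinkingBump_rOut hu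
    refine le_of_tendsto_of_tendsto (((lim a).sub_const (F a).re).sub_const (2 * ‖d‖ * ε))
      ((lim (a + d)).sub_const (F (a + d)).re) ?_
    filter_upwards [tendsto_shrinkingBump_rOut.eventually
      (gt_mem_nhds (lt_min hη (sub_pos.2 hs₁₂)))] with n hn
    have hsub : ∀ x ∈ ball z s₁, closedBall x (shrinkingBump n).rOut ⊆ closedBall z s₂ := by
      intro x hx w hw
      rw [mem_closedBall] at hw ⊢
      rw [mem_ball] at hx
      linarith [dist_triangle w x z, hn.trans_le (min_le_right _ _)]
    have hder : ∀ x ∈ ball z s₁, ∃ L : ℂ →L[ℝ] ℝ,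
        HasFDerivWithinAt (fun x => mollify (shrinkingBump n) u x - (F x).re) L (ball z s₁) x ∧
          -(2 * ‖d‖ * ε) ≤ L d := by
      intro x hx
      have hxs : x ∈ closedBall z s₂ := hsub x hx (mem_closedBall_self (shrinkingBump n).rOut_pos.le)
      obtain ⟨L, hL, hLd⟩ := hasFDerivAt_mollify hu.locallyIntegrable hΦ h (shrinkingBump n)
        ((hsub x hx).trans hcV)
      have h1 := (hF x (hcV hxs)).hasFDerivAt.restrictScalars ℝ
      have h2 := (Complex.reCLM.hasFDerivAt (x := F x)).comp x h1
      refine ⟨_, (hL.sub h2).hasFDerivWithinAt, ?_⟩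
      have h3 : (2 * (d * A x)).re - 2 * ‖d‖ * ε ≤ L d := by
        rw [hLd]
        apply le_integral_normed_mul hΦ
        filter_upwards [hd] with w hw hwx
        have hws : w ∈ closedBall z s₂ := hsub x hx (ball_subset_closedBall hwx)
        have h4 := hw (closedBall_subset_ball hs₂s hws)
        have h5 := hAη w hws x hxs ((mem_ball.1 hwx).trans (hn.trans_le (min_le_left _ _)))
        rw [dist_eq_norm] at h5
        have h6 := neg_le_of_abs_le (Complex.abs_re_le_norm (d * (A w - A x)))
        rw [norm_mul] at h6
        have h7 : ‖d‖ * ‖A w - A x‖ ≤ ‖d‖ * ε := by gcongr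
        have h8 : (2 * (d * Φ w)).re = 2 * (d * (Φ w - A w)).re + 2 * (d * (A w - A x)).re
            + (2 * (d * A x)).re := by
          simp
          ring
        rw [h8]
        linarith
      have h9 : (L - Complex.reCLM.comp
          (ContinuousLinearMap.restrictScalars ℝ (ContinuousLinearMap.toSpanSingleton ℂ (2 * A x)))) d
          = L d - (2 * (d * A x)).re := by
        simp
        ring
      refine le_trans ?_ h9.ge
      linarith
    choose! L hL hLd using hder
    obtain ⟨x, hx, he⟩ := domain_mvt hL (convex_ball z s₁) ha1 had1
    rw [add_sub_cancel_left] at he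
    have := hLd x ((convex_ball z s₁).segment_subset ha1 had1 hx)
    linarith
  refine le_of_forall_pos_le_add fun ε hε => ?_
  have := key (ε / (2 * ‖d‖ + 1)) (by positivity)
  have h2 : 2 * ‖d‖ * (ε / (2 * ‖d‖ + 1)) ≤ ε := by
    rw [mul_div_assoc', div_le_iff₀ (by positivity)]
    nlinarith [norm_nonneg d]
  linarith

/-! ### Circle means and subharmonic functions. -/

/-- Polar coordinates use angles in `(-π, π)`, circle means use `(0, 2π]`; up to null sets both are
fundamental domains for the same translations. -/
theorem ae_Ioo_iff_ae_Ioc_of_periodic {S : Set ℝ} (hS : MeasurableSet S)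
    (hper : ∀ θ, θ + 2 * Real.pi ∈ S ↔ θ ∈ S) :
    (∀ᵐ θ ∂volume.restrict (Ioo (-Real.pi) Real.pi), θ ∉ S) ↔
      ∀ᵐ θ ∂volume.restrict (Ioc 0 (2 * Real.pi)), θ ∉ S := by
  rw [restrict_Ioo_eq_restrict_Ioc, ae_restrict_iff' measurableSet_Ioc,
    ae_restrict_iff' measurableSet_Ioc]
  have hz : ∀ n : ℤ, ∀ θ, n • (2 * Real.pi) + θ ∈ S ↔ θ ∈ S := by
    have hnat : ∀ n : ℕ, ∀ θ, θ + n * (2 * Real.pi) ∈ S ↔ θ ∈ S := by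
      intro n
      induction n with
      | zero => simp
      | succ k ih =>
        intro θ
        rw [← ih θ, ← hper (θ + k * (2 * Real.pi))]
        push_cast
        ring_nf
    intro n θ
    obtain ⟨k, rfl | rfl⟩ := n.eq_nat_or_neg
    · rw [← hnat k θ]
      simp [add_comm]
    · rw [← hnat k (-(k : ℤ) • (2 * Real.pi) + θ)]
      simp [add_comm]
  have key := (isAddFundamentalDomain_Ioc Real.two_pi_pos (-Real.pi)).measure_set_eq
    (isAddFundamentalDomain_Ioc Real.two_pi_pos 0) hS (fun g => by
      obtain ⟨_, n, rfl⟩ := g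
      ext θ
      exact hz n θ)
  have e1 : -Real.pi + 2 * Real.pi = Real.pi := by ring
  rw [e1, zero_add] at key
  have conv : ∀ I : Set ℝ, (∀ᵐ θ, θ ∈ I → θ ∉ S) ↔ volume (S ∩ I) = 0 := by
    intro I
    rw [ae_iff]
    have : {θ | ¬(θ ∈ I → θ ∉ S)} = S ∩ I := by
      ext θ
      simp [and_comm]
    rw [this]
  rw [conv, conv, key]

/-- A measurable set is Lebesgue null if and only if almost every circle about `c` meets it in a
null set. -/
theorem volume_eq_zero_iff_ae_circleMap {E : Set ℂ} (hE : MeasurableSet E) (c : ℂ) :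
    volume E = 0 ↔ ∀ᵐ R ∂volume.restrict (Ioi (0 : ℝ)),
      ∀ᵐ θ ∂volume.restrict (Ioc 0 (2 * Real.pi)), circleMap c R θ ∉ E := by
  have hcm : Measurable fun x : ℝ × ℝ => circleMap c x.1 x.2 := by
    unfold circleMap
    fun_prop
  have hind : Measurable (E.indicator (1 : ℂ → ℝ≥0∞)) := measurable_one.indicator hE
  have hmeas : Measurable fun x : ℝ × ℝ =>
      ENNReal.ofReal x.1 • E.indicator (1 : ℂ → ℝ≥0∞) (circleMap c x.1 x.2) :=
    (ENNReal.measurable_ofReal.comp measurable_fst).smul (hind.comp hcm)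
  have h1 : volume E = ∫⁻ x in polarCoord.target,
      ENNReal.ofReal x.1 • E.indicator (1 : ℂ → ℝ≥0∞) (circleMap c x.1 x.2) := by
    rw [← lintegral_indicator_one hE, ← lintegral_add_left_eq_self _ c,
      ← Complex.lintegral_comp_polarCoord_symm]
    refine lintegral_congr fun x => ?_
    have : c + Complex.polarCoord.symm x = circleMap c x.1 x.2 := by
      rw [Complex.polarCoord_symm_apply, circleMap, Complex.exp_mul_I]
      push_cast
      rfl
    rw [this]
  rw [h1, lintegral_eq_zero_iff hmeas, polarCoord_target, Measure.volume_eq_prod,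
    ← Measure.prod_restrict]
  refine (Measure.ae_prod_iff_ae_ae (hmeas (measurableSet_singleton 0))).trans ?_
  refine eventually_congr ?_
  filter_upwards [ae_restrict_mem measurableSet_Ioi] with R hR
  have hS : MeasurableSet (circleMap c R ⁻¹' E) :=
    (continuous_circleMap c R).measurable hE
  refine Iff.trans ?_ (ae_Ioo_iff_ae_Ioc_of_periodic (S := circleMap c R ⁻¹' E) hS fun θ => ?_)
  · refine eventually_congr (Eventually.of_forall fun θ => ?_)
    have : ENNReal.ofReal R ≠ 0 := by simpa using hR
    simp [this]
  · rw [mem_preimage, mem_preimage, periodic_circleMap c R θ]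

theorem volume_Ioc_zero_two_pi : volume (Ioc 0 (2 * Real.pi)) = ENNReal.ofReal (2 * Real.pi) := by
  rw [Real.volume_Ioc, sub_zero]

theorem circleMean_coe_eq_circleAverage {Ψ : ℂ → EReal} {u : ℂ → ℝ} (hu : Continuous u) {c : ℂ}
    {R : ℝ} (h : ∀ᵐ θ ∂volume.restrict (Ioc 0 (2 * Real.pi)),
      Ψ (circleMap c R θ) = (u (circleMap c R θ) : EReal)) :
    circleMean Ψ c R = ((Real.circleAverage u c R : ℝ) : EReal) := by
  have hc : Continuous fun θ => u (circleMap c R θ) := hu.comp (continuous_circleMap c R)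
  have hint : IntegrableOn (fun θ => u (circleMap c R θ)) (Ioc 0 (2 * Real.pi)) :=
    hc.integrableOn_Ioc
  have e1 : ∫⁻ θ in Ioc 0 (2 * Real.pi), (Ψ (circleMap c R θ)).toENNReal =
      ∫⁻ θ in Ioc 0 (2 * Real.pi), ENNReal.ofReal (u (circleMap c R θ)) := by
    refine lintegral_congr_ae ?_
    filter_upwards [h] with θ hθ
    rw [hθ, EReal.real_coe_toENNReal]
  have e2 : ∫⁻ θ in Ioc 0 (2 * Real.pi), (-Ψ (circleMap c R θ)).toENNReal =
      ∫⁻ θ in Ioc 0 (2 * Real.pi), ENNReal.ofReal (-u (circleMap c R θ)) := by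
    refine lintegral_congr_ae ?_
    filter_upwards [h] with θ hθ
    rw [hθ, ← EReal.coe_neg, EReal.real_coe_toENNReal]
  have f1 : ∫⁻ θ in Ioc 0 (2 * Real.pi), ENNReal.ofReal (u (circleMap c R θ)) ≠ ⊤ :=
    hint.lintegral_lt_top.ne
  have f2 : ∫⁻ θ in Ioc 0 (2 * Real.pi), ENNReal.ofReal (-u (circleMap c R θ)) ≠ ⊤ :=
    hint.neg.lintegral_lt_top.ne
  have hcoe : ∀ x : ℝ≥0∞, x ≠ ⊤ →
      ((x / ENNReal.ofReal (2 * Real.pi) : ℝ≥0∞) : EReal) = ((x.toReal / (2 * Real.pi) : ℝ) : EReal) := by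
    intro x hx
    have hpi : ENNReal.ofReal (2 * Real.pi) ≠ 0 := by simpa using Real.pi_pos
    rw [← EReal.coe_ennreal_toReal (ENNReal.div_ne_top hx hpi), ENNReal.toReal_div,
      ENNReal.toReal_ofReal Real.two_pi_pos.le]
  rw [circleMean, setLAverage_eq, setLAverage_eq, e1, e2, volume_Ioc_zero_two_pi, hcoe _ f1,
    hcoe _ f2, ← EReal.coe_sub, Real.circleAverage_def,
    intervalIntegral.integral_of_le Real.two_pi_pos.le,
    integral_eq_lintegral_pos_part_sub_lintegral_neg_part hint, smul_eq_mul]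
  congr 1
  field_simp

theorem continuous_circleAverage {u : ℂ → ℝ} (hu : Continuous u) :
    Continuous fun x : ℂ × ℝ => Real.circleAverage u x.1 x.2 := by
  have h : Continuous fun x : (ℂ × ℝ) × ℝ => u (circleMap x.1.1 x.1.2 x.2) := by
    refine hu.comp ?_
    unfold circleMap
    fun_prop
  have h2 : Continuous fun x : ℂ × ℝ => ∫ θ in (0 : ℝ)..2 * Real.pi, u (circleMap x.1 x.2 θ) :=
    intervalIntegral.continuous_parametric_intervalIntegral_of_continuous' h _ _
  exact h2.const_smul (2 * Real.pi)⁻¹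

namespace IsSubharmonicOn

variable {Ψ : ℂ → EReal} {U : Set ℂ}

theorem measurableSet_inter_eq_bot (hΨ : IsSubharmonicOn Ψ U) (hU : IsOpen U) :
    MeasurableSet (U ∩ {z | Ψ z = ⊥}) := by
  have h : U ∩ {z | Ψ z = ⊥} = ⋂ n : ℕ, U ∩ Ψ ⁻¹' Iio ((-(n : ℝ) : ℝ) : EReal) := by
    ext z
    simp only [mem_inter_iff, mem_ofPred_eq, mem_iInter, mem_preimage, mem_Iio]
    refine ⟨fun h n => ⟨h.1, by rw [h.2]; exact EReal.bot_lt_coe _⟩, fun h => ⟨(h 0).1, ?_⟩⟩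
    rw [EReal.eq_bot_iff_forall_lt]
    intro y
    obtain ⟨n, hn⟩ := exists_nat_gt (-y)
    exact (h n).2.trans_le (by exact_mod_cast (by linarith : -(n : ℝ) ≤ y))
  rw [h]
  refine MeasurableSet.iInter fun n => ?_
  obtain ⟨v, hv, he⟩ := upperSemicontinuousOn_iff_preimage_Iio.1 hΨ.upperSemicontinuousOn
    ((-(n : ℝ) : ℝ) : EReal)
  rw [he]
  exact (hU.inter hv).measurableSet

theorem measurable_circleMap (hΨ : IsSubharmonicOn Ψ U) {c : ℂ} {R : ℝ} (hR : 0 ≤ R)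
    (hc : closedBall c R ⊆ U) : Measurable fun θ => Ψ (circleMap c R θ) := by
  have hmem : ∀ θ, circleMap c R θ ∈ U := fun θ => hc (circleMap_mem_closedBall c hR θ)
  refine UpperSemicontinuous.measurable fun θ y hy => ?_
  have h1 := hΨ.upperSemicontinuousOn _ (hmem θ) y hy
  exact (tendsto_nhdsWithin_iff.2 ⟨(continuous_circleMap c R).continuousAt,
    Eventually.of_forall hmem⟩).eventually h1

/-- A circle meeting the set where Ψ is -∞ in positive angular measure has mean -∞, contradicting
the sub-mean value inequality at `c`. -/
theorem volume_ball_inter_eq_bot (hΨ : IsSubharmonicOn Ψ U) (hU : IsOpen U) {c : ℂ} {ρ : ℝ}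
    (hc : ball c ρ ⊆ U) (hbot : Ψ c ≠ ⊥) : volume (ball c ρ ∩ {z | Ψ z = ⊥}) = 0 := by
  have hE : ball c ρ ∩ {z | Ψ z = ⊥} = ball c ρ ∩ (U ∩ {z | Ψ z = ⊥}) := by
    ext z
    exact ⟨fun h => ⟨h.1, hc h.1, h.2⟩, fun h => ⟨h.1, h.2.2⟩⟩
  have hmeas : MeasurableSet (ball c ρ ∩ {z | Ψ z = ⊥}) := by
    rw [hE]
    exact measurableSet_ball.inter (hΨ.measurableSet_inter_eq_bot hU)
  rw [volume_eq_zero_iff_ae_circleMap hmeas c]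
  filter_upwards [ae_restrict_mem measurableSet_Ioi] with R hR
  rw [mem_Ioi] at hR
  by_cases hRρ : R < ρ
  swap
  · refine Eventually.of_forall fun θ h => hRρ ?_
    have := h.1
    rwa [mem_ball, circleMap_mem_sphere c hR.le θ] at this
  have hcl : closedBall c R ⊆ U := (closedBall_subset_ball hRρ).trans hc
  have hle := hΨ.le_circleMean c R hR hcl
  have hfin : ∫⁻ θ in Ioc 0 (2 * Real.pi), (-Ψ (circleMap c R θ)).toENNReal ≠ ⊤ := by
    intro htop
    apply hbot
    rw [circleMean, setLAverage_eq _ (fun θ => (-Ψ (circleMap c R θ)).toENNReal), htop,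
      volume_Ioc_zero_two_pi, ENNReal.top_div_of_ne_top ENNReal.ofReal_ne_top] at hle
    simpa using hle
  have hm : Measurable fun θ => (-Ψ (circleMap c R θ)).toENNReal :=
    (hΨ.measurable_circleMap hR.le hcl).neg.ereal_toENNReal
  filter_upwards [ae_lt_top hm hfin] with θ hθ h
  have h2 : Ψ (circleMap c R θ) = ⊥ := h.2
  simp [h2] at hθ

/-- A subharmonic function is finite almost everywhere. -/
theorem volume_inter_eq_bot (hΨ : IsSubharmonicOn Ψ U) (hU : IsOpen U) (hUc : IsConnected U) :
    volume (U ∩ {z | Ψ z = ⊥}) = 0 := by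
  -- `X` is where the -∞ set is locally null and `Y` is the interior of that set. They are disjoint,
  -- open and cover `U`, so connectedness leaves only `X`.
  set X : Set ℂ := ⋃₀ {t | IsOpen t ∧ volume (t ∩ {z | Ψ z = ⊥}) = 0} with hX
  set Y : Set ℂ := {z | ∀ᶠ w in 𝓝 z, Ψ w = ⊥} with hY
  have hXo : IsOpen X := isOpen_sUnion fun t ht => ht.1
  have hYo : IsOpen Y := isOpen_setOfPred_eventually_nhds
  have hdis : ∀ z ∈ X, z ∉ Y := by
    rintro z ⟨t, ⟨hto, ht0⟩, hzt⟩ hzY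
    have hmem : t ∩ {z | Ψ z = ⊥} ∈ 𝓝 z := inter_mem (hto.mem_nhds hzt) hzY
    exact (Measure.measure_pos_of_mem_nhds volume hmem).ne' ht0
  have hcov : U ⊆ X ∪ Y := by
    intro z hz
    by_cases hzY : z ∈ Y
    · exact Or.inr hzY
    left
    obtain ⟨ρ, hρ, hball⟩ := Metric.isOpen_iff.1 hU z hz
    have hfreq : ∃ᶠ w in 𝓝 z, Ψ w ≠ ⊥ := not_eventually.1 hzY
    obtain ⟨w, hw, hwz⟩ := (hfreq.and_eventually (ball_mem_nhds z (half_pos hρ))).exists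
    refine ⟨ball w (ρ / 2), ⟨isOpen_ball, hΨ.volume_ball_inter_eq_bot hU ?_ hw⟩, ?_⟩
    · intro x hx
      apply hball
      rw [mem_ball] at *
      linarith [dist_triangle x w z]
    · rw [mem_ball, dist_comm]
      exact hwz
  have hUX : U ⊆ X := by
    by_contra hnot
    obtain ⟨z, hzU, hzX⟩ := not_subset.1 hnot
    have hzY := (hcov hzU).resolve_left hzX
    obtain ⟨c, hcU, hc⟩ := hΨ.exists_ne_bot
    have hcX : c ∈ X := (hcov hcU).resolve_right fun h => hc h.self_of_nhds
    obtain ⟨x, -, hxX, hxY⟩ := hUc.isPreconnected X Y hXo hYo hcov ⟨c, hcU, hcX⟩ ⟨z, hzU, hzY⟩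
    exact hdis x hxX hxY
  refine measure_null_of_locally_null _ fun x hx => ?_
  obtain ⟨t, ⟨hto, ht0⟩, hxt⟩ := hUX hx.1
  refine ⟨t ∩ {z | Ψ z = ⊥}, ?_, ht0⟩
  exact mem_of_superset (inter_mem (mem_nhdsWithin_of_mem_nhds (hto.mem_nhds hxt)) self_mem_nhdsWithin)
    fun w hw => ⟨hw.1, hw.2.2⟩

/-- The sub-mean value inequality passes to a continuous representative. -/
theorem le_circleAverage_of_ae_eq (hΨ : IsSubharmonicOn Ψ U) {u : ℂ → ℝ} (hu : Continuous u)
    {V : Set ℂ} (hV : IsOpen V) (hVU : V ⊆ U) (hae : ∀ᵐ w, w ∈ V → Ψ w = (u w : EReal)) {c : ℂ}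
    {R : ℝ} (hR : 0 < R) (hc : closedBall c R ⊆ V) : u c ≤ Real.circleAverage u c R := by
  obtain ⟨E, hEsub, hEm, hE0⟩ := exists_measurable_superset_of_null (ae_iff.1 hae)
  have hgood : ∀ w, w ∉ E → w ∈ V → Ψ w = (u w : EReal) := fun w hw => by
    by_contra hcon
    exact hw (hEsub hcon)
  by_contra! hlt
  obtain ⟨δ, hδ, hthick⟩ := (isCompact_closedBall c R).exists_cthickening_subset_open hV hc
  rw [cthickening_closedBall hδ.le hR.le] at hthick
  -- A failure at `(c, R)` persists for nearby centres and radii, among which there is a centre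
  -- outside `E` whose circle meets `E` in a null set; there Ψ and `u` have the same value and mean.
  have hopen : ∀ᶠ x : ℂ × ℝ in 𝓝 (c, R), Real.circleAverage u x.1 x.2 < u x.1 ∧
      dist x.1 c + x.2 < δ + R ∧ 0 < x.2 := by
    refine Eventually.and ?_ (Eventually.and ?_ ?_)
    · exact (continuous_circleAverage hu).continuousAt.eventually_lt
        (hu.comp continuous_fst).continuousAt hlt
    · have : Continuous fun x : ℂ × ℝ => dist x.1 c + x.2 := by fun_prop
      exact this.continuousAt.eventually (gt_mem_nhds (by simpa using hδ))
    · exact continuous_snd.continuousAt.eventually (lt_mem_nhds hR)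
  obtain ⟨ε, hε, hball⟩ := Metric.eventually_nhds_iff_ball.1 hopen
  obtain ⟨c', hc'E, hc'⟩ : ∃ c', c' ∉ E ∧ c' ∈ ball c ε := by
    by_contra! hcon
    exact (measure_ball_pos volume c hε).ne' (measure_mono_null
      (fun w hw => by_contra fun hwE => hcon w hwE hw) hE0)
  have hpol := (volume_eq_zero_iff_ae_circleMap hEm c').1 hE0
  rw [ae_restrict_iff' measurableSet_Ioi] at hpol
  obtain ⟨R', hR', hR'R⟩ : ∃ R', (R' ∈ Ioi (0 : ℝ) →
      ∀ᵐ θ ∂volume.restrict (Ioc 0 (2 * Real.pi)), circleMap c' R' θ ∉ E) ∧ R' ∈ ball R ε := by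
    by_contra! hcon
    exact (measure_ball_pos volume R hε).ne' (measure_mono_null
      (fun w hw => fun hwE => hcon w hwE hw) (ae_iff.1 hpol))
  obtain ⟨h1, h2, h3⟩ := hball (c', R') (by rw [← ball_prod_same]; exact ⟨hc', hR'R⟩)
  simp only at h1 h2 h3
  have hcl : closedBall c' R' ⊆ V := by
    refine subset_trans (fun w hw => ?_) hthick
    rw [mem_closedBall] at hw ⊢
    linarith [dist_triangle w c' c]
  have hmean := circleMean_coe_eq_circleAverage (Ψ := Ψ) hu (c := c') (R := R') (by
    filter_upwards [hR' h3] with θ hθ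
    exact hgood _ hθ (hcl (circleMap_mem_closedBall c' h3.le θ)))
  have hle := hΨ.le_circleMean c' R' h3 (hcl.trans hVU)
  rw [hmean, hgood c' hc'E (hcl (mem_closedBall_self h3.le)), EReal.coe_le_coe_iff] at hle
  linarith

end IsSubharmonicOn

/-! ### Passage from Ψ to the local setting. -/

theorem dz_eq_zero_of_notMem_tsupport {φ : ℂ → ℂ} {w : ℂ} (hw : w ∉ tsupport φ) : dz φ w = 0 := by
  have h : φ =ᶠ[𝓝 w] fun _ => 0 := notMem_tsupport_iff_eventuallyEq.1 hw
  simp [dz, h.fderiv_eq]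

theorem TestsDz.mono {f : ℂ → ℝ} {Φ : ℂ → ℂ} {V W : Set ℂ} (h : TestsDz f Φ V) (hWV : W ⊆ V) :
    TestsDz f Φ W :=
  fun φ h1 h2 h3 => h φ h1 h2 (h3.trans hWV)

theorem TestsDz.congr {f f' : ℂ → ℝ} {Φ Φ' : ℂ → ℂ} {V : Set ℂ} (h : TestsDz f Φ V)
    (hf : ∀ᵐ w, w ∈ V → f w = f' w) (hΦ : ∀ᵐ w, w ∈ V → Φ w = Φ' w) : TestsDz f' Φ' V := by
  intro φ h1 h2 h3
  have e1 : ∫ w, Φ' w * φ w = ∫ w, Φ w * φ w := by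
    refine integral_congr_ae ?_
    filter_upwards [hΦ] with w hw
    by_cases hwφ : w ∈ tsupport φ
    · rw [hw (h3 hwφ)]
    · rw [image_eq_zero_of_notMem_tsupport hwφ, mul_zero, mul_zero]
  have e2 : ∫ w, (f' w : ℂ) * dz φ w = ∫ w, (f w : ℂ) * dz φ w := by
    refine integral_congr_ae ?_
    filter_upwards [hf] with w hw
    by_cases hwφ : w ∈ tsupport φ
    · rw [hw (h3 hwφ)]
    · rw [dz_eq_zero_of_notMem_tsupport hwφ, mul_zero, mul_zero]
  rw [e1, e2]
  exact h φ h1 h2 h3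

theorem IsPiecewiseAnalytic.ae_mem_iUnion {r : ℕ} {Φ : ℂ → ℂ} {U : Set ℂ} {M : Fin r → Set ℂ}
    {A : Fin r → ℂ → ℂ} (h : IsPiecewiseAnalytic Φ U M A) : ∀ᵐ w, w ∈ U → w ∈ ⋃ i, M i := by
  rw [ae_iff]
  refine measure_mono_null (fun w hw => ?_) h.null_compl
  simpa using hw

/-- Near every point, a subharmonic function with piecewise analytic derivative has a continuous
representative of the kind studied above. -/
theorem exists_isPiecewisePrimitive {r : ℕ} {U : Set ℂ} (hUo : IsOpen U) (hUc : IsConnected U)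
    {Ψ : ℂ → EReal} (hΨ : IsSubharmonicOn Ψ U) {Φ : ℂ → ℂ}
    (hΦ : HasDistribDz (fun z => ((Ψ z).toReal : ℂ)) Φ U) {M : Fin r → Set ℂ} {A : Fin r → ℂ → ℂ}
    (hMA : IsPiecewiseAnalytic Φ U M A) {p : ℂ} (hp : p ∈ U) :
    ∃ (ρ₀ : ℝ) (F : Fin r → ℂ → ℂ) (u : ℂ → ℝ), ball p ρ₀ ⊆ U ∧
      IsPiecewisePrimitive p ρ₀ A F M u ∧ ∀ᵐ w, w ∈ ball p ρ₀ → Ψ w = (u w : EReal) := by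
  obtain ⟨R, hR, hRU⟩ := nhds_basis_closedBall.mem_iff.1 (hUo.mem_nhds hp)
  have hbU : ball p R ⊆ U := ball_subset_closedBall.trans hRU
  have hcomp : IsCompact (closedBall p R) := isCompact_closedBall p R
  -- `toReal` sends -∞ to 0, so the real-valued function in the hypothesis represents Ψ only because
  -- the -∞ set is null.
  have hfinite : ∀ᵐ w, w ∈ U → Ψ w = ((Ψ w).toReal : EReal) := by
    have h0 := hΨ.volume_inter_eq_bot hUo hUc
    rw [← compl_compl (U ∩ _), ← mem_ae_iff] at h0
    filter_upwards [h0] with w hw hwU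
    exact (EReal.coe_toReal (hΨ.lt_top w hwU).ne fun hbot => hw ⟨hwU, hbot⟩).symm
  -- Cutting off to a disc makes both functions locally integrable on the whole plane, as
  -- convolution requires.
  set f : ℂ → ℝ := (ball p R).indicator fun z => (Ψ z).toReal with hf
  set Φ₁ : ℂ → ℂ := (ball p R).indicator Φ with hΦ₁
  have hfint : LocallyIntegrable f := by
    have h1 := (hΦ.locallyIntegrableOn_left.integrableOn_compact_subset hRU hcomp).mono_set
      ball_subset_closedBall
    have h2 : IntegrableOn (fun z => (Ψ z).toReal) (ball p R) := by
      simpa [IntegrableOn] using Integrable.re h1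
    exact (h2.integrable_indicator measurableSet_ball).locallyIntegrable
  have hΦint : LocallyIntegrable Φ₁ :=
    (((hΦ.locallyIntegrableOn_right.integrableOn_compact_subset hRU hcomp).mono_set
      ball_subset_closedBall).integrable_indicator measurableSet_ball).locallyIntegrable
  have htest : TestsDz f Φ₁ (ball p R) := by
    have h0 : TestsDz (fun z => (Ψ z).toReal) Φ (ball p R) := fun φ h1 h2 h3 =>
      hΦ.integral_eq φ h1 h2 (h3.trans hbU)
    exact h0.congr (Eventually.of_forall fun w hw => (indicator_of_mem hw fun z => (Ψ z).toReal).symm)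
      (Eventually.of_forall fun w hw => (indicator_of_mem hw _).symm)
  have hval : ∀ᵐ w, w ∈ ball p R → ∃ i, w ∈ M i ∧ Φ₁ w = A i w := by
    filter_upwards [hMA.ae_mem_iUnion] with w hw hwR
    obtain ⟨i, hi⟩ := mem_iUnion.1 (hw (hbU hwR))
    exact ⟨i, hi, (indicator_of_mem hwR _).trans (hMA.eqOn i hi)⟩
  have hAc : ∀ i, ContinuousOn (A i) (closedBall p R) := fun i =>
    (hMA.analytic i).continuousOn.mono hRU
  choose C hC using fun i => hcomp.exists_bound_of_continuousOn (hAc i)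
  have hbound : ∀ᵐ w, w ∈ ball p R → ‖Φ₁ w‖ ≤ ∑ i, |C i| := by
    filter_upwards [hval] with w hw hwR
    obtain ⟨i, -, hi⟩ := hw hwR
    rw [hi]
    exact (hC i w (ball_subset_closedBall hwR)).trans ((le_abs_self _).trans
      (Finset.single_le_sum (f := fun i => |C i|) (fun j _ => abs_nonneg _) (Finset.mem_univ i)))
  obtain ⟨u, hu, hfu⟩ := exists_continuous_ae_eq hR hfint hΦint htest hbound
  have hhalf : ball p (R / 2) ⊆ ball p R := ball_subset_ball (by linarith)
  have hΨu : ∀ᵐ w, w ∈ ball p (R / 2) → Ψ w = (u w : EReal) := by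
    filter_upwards [hfu, hfinite] with w h1 h2 hw
    rw [h2 (hbU (hhalf hw)), ← h1 hw, hf, indicator_of_mem (hhalf hw)]
  have htestu : TestsDz u Φ₁ (ball p (R / 2)) :=
    (htest.mono hhalf).congr hfu (Eventually.of_forall fun _ _ => rfl)
  have hprim : ∀ i, ∃ F : ℂ → ℂ, ∀ w ∈ ball p (R / 2), HasDerivAt F (2 * A i w) w := by
    intro i
    have hd : DifferentiableOn ℂ (fun w => 2 * A i w) (ball p (R / 2)) := fun w hw =>
      (((hMA.analytic i) w (hbU (hhalf hw))).differentiableAt.const_mul 2).differentiableWithinAt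
    exact hd.isExactOn_ball
  choose F hF using hprim
  refine ⟨R / 2, F, u, hhalf.trans hbU, ?_, hΨu⟩
  refine
    { pos := half_pos hR
      continuousOn := fun i => (hAc i).mono (hhalf.trans ball_subset_closedBall)
      hasDerivAt := hF
      isOpen := hMA.isOpen
      disjoint := hMA.disjoint
      continuous := hu
      dense := ?_
      mono := ?_
      submean := fun c s hs hc =>
        hΨ.le_circleAverage_of_ae_eq hu isOpen_ball (hhalf.trans hbU) hΨu hs hc }
  · intro w hw
    rw [mem_closure_iff_nhds]
    intro t ht
    by_contra hcon
    have hsub : t ∩ ball p (R / 2) ⊆ U \ ⋃ i, M i := fun x hx =>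
      ⟨hbU (hhalf hx.2), fun hxM => hcon ⟨x, hx.1, hxM⟩⟩
    exact (Measure.measure_pos_of_mem_nhds volume (inter_mem ht (isOpen_ball.mem_nhds hw))).ne'
      (measure_mono_null hsub hMA.null_compl)
  · intro k z s d hzs hd a ha had
    refine le_of_testsDz hu hΦint htestu ((hAc k).mono (hhalf.trans ball_subset_closedBall)) (hF k)
      hzs ?_ ha had
    filter_upwards [hval] with w hw hwz
    obtain ⟨i, hi, he⟩ := hw (hhalf (hzs hwz))
    rw [he]
    exact hd i w hi hwz

theorem corollary3 {r : ℕ} (U : Set ℂ) (hUo : IsOpen U) (hUc : IsConnected U)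
    (Ψ : ℂ → EReal) (hΨ : IsSubharmonicOn Ψ U)
    (Φ : ℂ → ℂ) (hΦ : HasDistribDz (fun z => ((Ψ z).toReal : ℂ)) Φ U)
    (M : Fin r → Set ℂ) (A : Fin r → ℂ → ℂ) (hMA : IsPiecewiseAnalytic Φ U M A)
    (p : ℂ) (hp : p ∈ U)
    (h1 : ∀ i, p ∈ closure (M i))
    (h2 : ∀ i j k, i ≠ j → j ≠ k → i ≠ k → ∀ t : ℝ, A i p - A k p ≠ t * (A j p - A k p))
    (h3 : ∀ i k, i ≠ k → A i p ≠ A k p) :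
    ∃ N : Set ℂ, IsOpen N ∧ p ∈ N ∧ N ⊆ U ∧
      ∃ H : Fin r → ℂ → ℝ, (∀ i, InnerProductSpace.HarmonicOnNhd (H i) N) ∧
        ∀ᵐ z ∂(volume.restrict N), IsGreatest (range fun i => ((H i z : ℝ) : EReal)) (Ψ z) := by
  obtain ⟨ρ₀, F, u, hρU, h, hΨu⟩ := exists_isPiecewisePrimitive hUo hUc hΨ hΦ hMA hp
  obtain ⟨c, hc⟩ := h.isMaxAt_center h2 h3
  obtain ⟨ε, hε, hball⟩ := Metric.eventually_nhds_iff_ball.1 (hc.and (ball_mem_nhds p h.pos))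
  refine ⟨ball p ε, isOpen_ball, mem_ball_self hε, fun w hw => hρU (hball w hw).2,
    fun i w => (F i w).re + c i, fun i w hw => ?_, ?_⟩
  · exact (h.harmonicAt_re i (hball w hw).2).add (InnerProductSpace.harmonicAt_const (c i))
  · rw [ae_restrict_iff' measurableSet_ball]
    filter_upwards [hΨu] with w hw hwε
    rw [hw (hball w hwε).2]
    obtain ⟨⟨i, hi⟩, hub⟩ := (hball w hwε).1
    refine ⟨⟨i, congrArg _ hi⟩, ?_⟩
    rintro _ ⟨j, rfl⟩
    exact EReal.coe_le_coe_iff.2 (hub ⟨j, rfl⟩)
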